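/- Let $C$ be a smooth complex projective curve, regarded as a compact connected Riemann surface. Let $\mathrm{Aut}(C)^2\subset \mathrm{Aut}(C\times C)$ be the group of automorphisms $(x,y)\mapsto (gx,hy)$ with $g,h\in\mathrm{Aut}(C)$, and let $\mathrm{Aut}(C)(2)$ be the subgroup generated by $\mathrm{Aut}(C)^2$ and the exchange of factors $(x,y)\mapsto(y,x)$. A mixed action on $C\times C$ is a finite subgroup $G\subset \mathrm{Aut}(C)(2)$ not contained in $\mathrm{Aut}(C)^2$; put $G^0=G\cap \mathrm{Aut}(C)^2$. The mixed action is minimal if $G^0$ acts faithfully on both factors. Let $G$ be a minimal mixed action on $C\times C$, and let $G^0$ act on $C$ through the first factor. Let $\Sigma\subset G^0$ be the set of elements fixing at least one point of $C$, and let $K\subset G^0$ be the smallest subgroup of $G^0$ that is normal in $G$ and contains $\Sigma$, the commutator subgroup $[G^0,G^0]$ and $\{g^2 \mid g\in G\setminus G^0\}$. Let $G_K\subset\mathrm{Aut}(C\times C)$ be the group generated by $G$ and $K\times\{1\}$, where $(k,1)$ acts by $(x,y)\mapsto(kx,y)$. Quotients by finite groups carry the quotient complex structure (the holomorphic functions on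 an open subset are those whose pullback is holomorphic). For an abelian group $A$ let $D(A)=A\rtimes\mathbb{Z}/2\mathbb{Z}$, the generator of $\mathbb{Z}/2\mathbb{Z}$ acting on $A$ by inversion. If a finite abelian group $A$ acts freely by automorphisms on a curve $C'$, the dihedral surface $X_{C',A}$ is the quotient of $C'\times C'$ by the mixed action of $D(A)$ in which $a\in A$ acts by $(x,y)\mapsto(ax,a^{-1}y)$ and the generator of $\mathbb{Z}/2\mathbb{Z}$ exchanges the factors. Then: 1. $G^0/K$ is abelian, and there is an isomorphism $G/K\cong D(G^0/K)$ which is the identity on $G^0/K$; 2. the quotient $C/K$ is a compact connected Riemann surface, and the induced action of $G^0/K$ on $C/K$ is a free action by automorphisms; 3. the induced action of $D(G^0/K)$ on $C/K\times C/K$ is a minimal mixed action, and $(C\times C)/G_K$ is isomorphic, as a complex space, to the dihedral surface $X_{C/K,\,G^0/K}$; for a suitable $\psi\in\mathrm{Aut}(C)$ an isomorphism is induced by the map $(x,y)\mapsto([x],[\psi(y)])$ from $C\times C$ to $C/K\times C/K$. -/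

import Mathlib

open scoped Manifold ContDiff

/-- A curve: a compact connected Riemann surface (equivalently, a smooth connected projective
curve over the complex numbers). -/
structure IsCurve (C : Type*) [TopologicalSpace C] [ChartedSpace ℂ C] : Prop where
  isManifold : IsManifold 𝓘(ℂ, ℂ) ω C
  t2Space : T2Space C
  compactSpace : CompactSpace C
  connectedSpace : ConnectedSpace C

section Automorphisms

variable (C : Type*) [TopologicalSpace C] [ChartedSpace ℂ C]

/-- `Aut(C)`: the bijections of `C` that are holomorphic together with their inverses. -/
def HolAut : Subgroup (Equiv.Perm C) where
  carrier := {f | MDifferentiable 𝓘(ℂ, ℂ) 𝓘(ℂ, ℂ) f ∧ MDifferentiable 𝓘(ℂ, ℂ) 𝓘(ℂ, ℂ) f.symm}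
  one_mem' := ⟨mdifferentiable_id, mdifferentiable_id⟩
  mul_mem' := fun hf hg => ⟨hf.1.comp hg.1, hg.2.comp hf.2⟩
  inv_mem' := fun hf => ⟨hf.2, hf.1⟩

end Automorphisms

/-- The homomorphism sending `(g, h)` to the permutation `(x, y) ↦ (g x, h y)` of `C × C`. -/
def prodAut (C : Type*) : Equiv.Perm C × Equiv.Perm C →* Equiv.Perm (C × C) where
  toFun p := Equiv.prodCongr p.1 p.2
  map_one' := rfl
  map_mul' _ _ := rfl

/-- The exchange of the factors `σ (x, y) = (y, x)`. -/
def swapAut (C : Type*) : Equiv.Perm (C × C) := Equiv.prodComm C C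

section MixedActions

variable (C : Type*) [TopologicalSpace C] [ChartedSpace ℂ C]

/-- `Aut(C)²`: the automorphisms `(x, y) ↦ (g x, h y)` of `C × C` with `g, h ∈ Aut(C)`. -/
def AutSq : Subgroup (Equiv.Perm (C × C)) :=
  ((HolAut C).prod (HolAut C)).map (prodAut C)

/-- `Aut(C)(2)`: the smallest group of automorphisms of `C × C` containing `Aut(C)²` and `σ`. -/
def AutTwo : Subgroup (Equiv.Perm (C × C)) :=
  AutSq C ⊔ Subgroup.zpowers (swapAut C)

variable {C}

/-- A mixed action: a finite subgroup of `Aut(C)(2)` that is not contained in `Aut(C)²`. -/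
structure IsMixedAction (G : Subgroup (Equiv.Perm (C × C))) : Prop where
  finite : Finite G
  le_autTwo : G ≤ AutTwo C
  not_le_autSq : ¬ G ≤ AutSq C

/-- The subgroup `G⁰ = G ∩ Aut(C)²` of the elements of `G` that preserve the factors. -/
def mixedG0 (G : Subgroup (Equiv.Perm (C × C))) : Subgroup G :=
  (AutSq C).subgroupOf G

/-- A mixed action is minimal if `G⁰` acts faithfully on both factors. -/
structure IsMinimalMixedAction (G : Subgroup (Equiv.Perm (C × C))) : Prop
    extends IsMixedAction G where
  faithful_fst : ∀ g h : Equiv.Perm C, g ∈ HolAut C → h ∈ HolAut C →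
    prodAut C (g, h) ∈ G → g = 1 → h = 1
  faithful_snd : ∀ g h : Equiv.Perm C, g ∈ HolAut C → h ∈ HolAut C →
    prodAut C (g, h) ∈ G → h = 1 → g = 1

/-- `Σ`: the elements of `G⁰` that, acting on `C` through the first factor, fix a point of `C`. -/
def mixedSigma (G : Subgroup (Equiv.Perm (C × C))) : Set G :=
  {γ | ∃ g ∈ HolAut C, ∃ h ∈ HolAut C,
    (γ : Equiv.Perm (C × C)) = prodAut C (g, h) ∧ ∃ x : C, g x = x}

/-- `K`: the smallest normal subgroup of `G` containing `Σ`, the commutators of elements of `G⁰`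
and the squares of the elements of `G` outside `G⁰`. All these elements lie in the normal subgroup
`G⁰` of `G`, hence so does `K`. -/
def mixedK (G : Subgroup (Equiv.Perm (C × C))) : Subgroup G :=
  Subgroup.normalClosure
    (mixedSigma G ∪ {k | ∃ g ∈ mixedG0 G, ∃ h ∈ mixedG0 G, k = g * h * g⁻¹ * h⁻¹}
      ∪ {k | ∃ g, g ∉ mixedG0 G ∧ k = g ^ 2})

instance mixedK_normal (G : Subgroup (Equiv.Perm (C × C))) : (mixedK G).Normal :=
  Subgroup.normalClosure_normal

/-- The group `K` as a group of automorphisms of `C`, through its action on the first factor. -/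
def mixedKFst (G : Subgroup (Equiv.Perm (C × C))) : Subgroup (Equiv.Perm C) :=
  (((mixedK G).map G.subtype).comap (prodAut C)).map (MonoidHom.fst _ _)

/-- `G_K`: the group of automorphisms of `C × C` generated by `G` and `K × {1}`, where `K × {1}`
acts by `(x, y) ↦ (k x, y)`. -/
def mixedGK (G : Subgroup (Equiv.Perm (C × C))) : Subgroup (Equiv.Perm (C × C)) :=
  G ⊔ ((mixedKFst G).prod ⊥).map (prodAut C)

/-- The quotient group `G⁰ / K`. -/
abbrev G0ModK (G : Subgroup (Equiv.Perm (C × C))) : Type _ :=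
  mixedG0 G ⧸ (mixedK G).subgroupOf (mixedG0 G)

end MixedActions

section Quotients

/-- The quotient `M / Γ` of a space by a group of permutations: the space of orbits, with the
quotient topology. -/
abbrev OrbitSpace {M : Type*} (Γ : Subgroup (Equiv.Perm M)) : Type _ :=
  MulAction.orbitRel.Quotient Γ M

/-- The projection `M → M / Γ`. -/
def orbitMk {M : Type*} (Γ : Subgroup (Equiv.Perm M)) (x : M) : OrbitSpace Γ :=
  Quotient.mk _ x

variable {E H M : Type*} [NormedAddCommGroup E] [NormedSpace ℂ E] [TopologicalSpace H]
  [TopologicalSpace M] [ChartedSpace H M]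
  {E' H' M' : Type*} [NormedAddCommGroup E'] [NormedSpace ℂ E'] [TopologicalSpace H']
  [TopologicalSpace M'] [ChartedSpace H' M']

/-- The structure sheaf of the complex space `M / Γ`: a function on an open subset `V` of `M / Γ`
is holomorphic if its pullback to the preimage of `V` in `M` is. -/
def IsHolOnQuotient (I : ModelWithCorners ℂ E H) (Γ : Subgroup (Equiv.Perm M))
    (V : Set (OrbitSpace Γ)) (f : OrbitSpace Γ → ℂ) : Prop :=
  MDifferentiableOn I 𝓘(ℂ, ℂ) (f ∘ orbitMk Γ) (orbitMk Γ ⁻¹' V)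

/-- A homeomorphism `M / Γ ≃ M' / Γ'` is an isomorphism of complex spaces if it identifies the
holomorphic functions on open subsets. -/
def IsBiholomorphism (I : ModelWithCorners ℂ E H) (I' : ModelWithCorners ℂ E' H')
    (Γ : Subgroup (Equiv.Perm M)) (Γ' : Subgroup (Equiv.Perm M'))
    (e : OrbitSpace Γ ≃ₜ OrbitSpace Γ') : Prop :=
  ∀ V : Set (OrbitSpace Γ'), IsOpen V → ∀ f : OrbitSpace Γ' → ℂ,
    IsHolOnQuotient I' Γ' V f ↔ IsHolOnQuotient I Γ (e ⁻¹' V) (f ∘ e)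

/-- A complex structure on the orbit space of a group of permutations `Γ` of a Riemann surface is
the quotient structure if its holomorphic functions on open subsets are those of `C / Γ`. -/
def IsQuotientStructure {C : Type*} [TopologicalSpace C] [ChartedSpace ℂ C]
    (Γ : Subgroup (Equiv.Perm C)) [ChartedSpace ℂ (OrbitSpace Γ)] : Prop :=
  ∀ V : Set (OrbitSpace Γ), IsOpen V → ∀ f : OrbitSpace Γ → ℂ,
    MDifferentiableOn 𝓘(ℂ, ℂ) 𝓘(ℂ, ℂ) f V ↔ IsHolOnQuotient 𝓘(ℂ, ℂ) Γ V f

end Quotients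

section Dihedral

variable {A : Type*} [Group A]

/-- Inversion as an automorphism of an abelian group. -/
def invAut (hA : ∀ a b : A, a * b = b * a) : MulAut A where
  toFun a := a⁻¹
  invFun a := a⁻¹
  left_inv := inv_inv
  right_inv := inv_inv
  map_mul' a b := by rw [mul_inv_rev, hA]

/-- The action of `ℤ/2` on an abelian group in which the generator acts by inversion. -/
def invHom (hA : ∀ a b : A, a * b = b * a) : Multiplicative (ZMod 2) →* MulAut A where
  toFun s := if s = 1 then 1 else invAut hA
  map_one' := if_pos rfl
  map_mul' s t := by
    have h2 : invAut hA * invAut hA = 1 := by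
      ext a
      exact inv_inv a
    have key : ∀ s : Multiplicative (ZMod 2), s = 1 ∨ s = Multiplicative.ofAdd 1 := by decide
    have h1 : (Multiplicative.ofAdd (1 : ZMod 2)) ≠ 1 := by decide
    have h3 : (Multiplicative.ofAdd (1 : ZMod 2)) * Multiplicative.ofAdd 1 = 1 := by decide
    rcases key s with rfl | rfl <;> rcases key t with rfl | rfl <;> simp [h1, h2, h3]

/-- The generalized dihedral group `D(A) = A ⋊ ℤ/2` of an abelian group `A`. -/
abbrev GenDihedral (hA : ∀ a b : A, a * b = b * a) : Type _ :=
  A ⋊[invHom hA] Multiplicative (ZMod 2)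

/-- The action of `ℤ/2` on `C × C` in which the generator exchanges the factors. -/
def swapHom (C : Type*) : Multiplicative (ZMod 2) →* Equiv.Perm (C × C) where
  toFun s := if s = 1 then 1 else swapAut C
  map_one' := if_pos rfl
  map_mul' s t := by
    have h2 : swapAut C * swapAut C = 1 := rfl
    have key : ∀ s : Multiplicative (ZMod 2), s = 1 ∨ s = Multiplicative.ofAdd 1 := by decide
    have h1 : (Multiplicative.ofAdd (1 : ZMod 2)) ≠ 1 := by decide
    have h3 : (Multiplicative.ofAdd (1 : ZMod 2)) * Multiplicative.ofAdd 1 = 1 := by decide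
    rcases key s with rfl | rfl <;> rcases key t with rfl | rfl <;> simp [h1, h2, h3]

/-- The mixed action of `D(A)` on `C × C` induced by an action `ρ` of an abelian group `A` on `C`:
`a ∈ A` acts by `(x, y) ↦ (a x, a⁻¹ y)`, and the generator of `ℤ/2` exchanges the factors. -/
def dihedralHom {C : Type*} (hA : ∀ a b : A, a * b = b * a) (ρ : A →* Equiv.Perm C) :
    GenDihedral hA →* Equiv.Perm (C × C) :=
  SemidirectProduct.lift
    ((prodAut C).comp (ρ.prod (ρ.comp (invAut hA).toMonoidHom))) (swapHom C) (by
      intro s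
      have key : ∀ s : Multiplicative (ZMod 2), s = 1 ∨ s = Multiplicative.ofAdd 1 := by decide
      have h1 : (Multiplicative.ofAdd (1 : ZMod 2)) ≠ 1 := by decide
      ext a : 1
      rcases key s with rfl | rfl
      · simp
      · have h4 : invHom hA (Multiplicative.ofAdd 1) a = a⁻¹ := by simp [invHom, h1, invAut]
        have h5 : swapHom C (Multiplicative.ofAdd 1) = swapAut C := by simp [swapHom, h1]
        have h6 : ∀ b : A, invAut hA b = b⁻¹ := fun _ => rfl
        simp only [MonoidHom.comp_apply, MulEquiv.coe_toMonoidHom, MonoidHom.prod_apply,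
          MulAut.conj_apply, h4, h5, h6, inv_inv]
        rfl)

/-- The group of automorphisms of `C × C` given by the induced mixed action of `D(A)`. -/
def dihedralMixed {C : Type*} (hA : ∀ a b : A, a * b = b * a) (ρ : A →* Equiv.Perm C) :
    Subgroup (Equiv.Perm (C × C)) :=
  (dihedralHom hA ρ).range

end Dihedral

/-!
Modulo `K` the group `G⁰` is abelian and every element of `G` outside `G⁰` is an involution, so for
`τ` outside `G⁰` and `γ` in `G⁰` the relation `(τ γ)² ∈ K` says that `τ` inverts `γ` modulo `K`;
this is `G / K ≅ D(G⁰ / K)` (`exists_mulEquiv_genDihedral`). The action of `G⁰ / K` on `C / K` is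
free: if `γ x = k x` with `k` in `K`, then `k⁻¹ γ` fixes `x`, hence lies in `Σ ⊆ K`.

Write `τ (x, y) = (a y, b x)` and take `ψ = a`. Under `(x, y) ↦ ([x], [a y])` the element `τ`
becomes the exchange of the factors, since `a b` is the action of `τ² ∈ K`, and an element `(g, h)`
of `G⁰` acts on the second coordinate by `a h a⁻¹`, the first factor of its conjugate by `τ`, which
is its inverse modulo `K`. As `K × {1}` and its conjugates by `τ` lie in `G_K`, the fibres of the
map lie in orbits of `G_K`, and the orbits of `G_K` correspond to those of the dihedral group
(`orbitMk_twistedProj_eq_iff`).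

The analytic input is the complex structure on the quotient of a Riemann surface by a finite group
`Γ` of automorphisms (`IsCurve.exists_quotient`). Averaging over the stabilizer of a point yields a
coordinate `φ` on which the stabilizer acts through a character onto the `n`-th roots of unity, so
that `φ ^ n` is a coordinate on the quotient (`exists_coord_pow_eq_iff`), and holomorphy descends
along `z ↦ z ^ n` (`differentiableOn_of_comp_pow`). A function on `C / K × C / K` whose pullback to
`C × C` is holomorphic is continuous and separately holomorphic, hence holomorphic by Osgood's lemma
(`differentiableOn_of_separately`), so the homeomorphism of quotients is biholomorphic.
-/

open Filter Topology

/-! ### Osgood's lemma and holomorphy along powers -/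

/-- **Osgood's lemma** in two variables: a continuous function that is holomorphic in each variable
is holomorphic. With `D (u, v)` the slope between `a` and `u` of `F (·, v)`, one has
`F (u, v) = F (a, v) + (u - a) * D (u, v)`, and the maximum principle in `u` shows that `D` is
continuous at `(a, b)`. -/
theorem differentiableOn_of_separately {F : ℂ × ℂ → ℂ} {s : Set (ℂ × ℂ)} (hs : IsOpen s)
    (hc : ContinuousOn F s)
    (h1 : ∀ p ∈ s, DifferentiableAt ℂ (fun u => F (u, p.2)) p.1)
    (h2 : ∀ p ∈ s, DifferentiableAt ℂ (fun v => F (p.1, v)) p.2) :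
    DifferentiableOn ℂ F s := by
  rintro ⟨a, b⟩ hab
  apply DifferentiableAt.differentiableWithinAt
  obtain ⟨R, hR, hRs⟩ := Metric.nhds_basis_closedBall.mem_iff.1 (hs.mem_nhds hab)
  have hmem : ∀ u ∈ Metric.closedBall a R, ∀ v ∈ Metric.closedBall b R, (u, v) ∈ s := by
    intro u hu v hv
    apply hRs
    rw [← closedBall_prod_same]
    exact ⟨hu, hv⟩
  have hb : b ∈ Metric.closedBall b R := Metric.mem_closedBall_self hR.le
  set D : ℂ → ℂ → ℂ := fun v => dslope (fun u => F (u, v)) a with hD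
  have hDd : ∀ v ∈ Metric.closedBall b R, DifferentiableOn ℂ (D v) (Metric.closedBall a R) := by
    intro v hv
    rw [hD, Complex.differentiableOn_dslope (Metric.closedBall_mem_nhds a hR)]
    intro u hu
    exact (h1 (u, v) (hmem u hu v hv)).differentiableWithinAt
  have hDs : ∀ u v, F (u, v) = F (a, v) + (u - a) * D v u := by
    intro u v
    have := sub_smul_dslope (fun u => F (u, v)) a u
    rw [smul_eq_mul] at this
    simp only [hD]
    rw [this]
    ring
  have hcirc : ∀ ε > 0, ∀ᶠ v in 𝓝 b, ∀ ζ ∈ Metric.sphere a R, ‖D v ζ - D b ζ‖ < ε := by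
    intro ε hε
    apply (isCompact_sphere a R).eventually_forall_of_forall_eventually
    intro ζ hζ
    have hζa : ζ ≠ a := by
      rintro rfl
      simp at hζ
      exact hR.ne' hζ.symm
    have hζb : (ζ, b) ∈ s := hmem ζ (Metric.sphere_subset_closedBall hζ) b hb
    have hFat : ∀ p ∈ s, ContinuousAt F p := fun p hp => hc.continuousAt (hs.mem_nhds hp)
    have hcont : ContinuousAt (fun z : ℂ × ℂ =>
        (z.2 - a)⁻¹ * (F (z.2, z.1) - F (a, z.1)) - (z.2 - a)⁻¹ * (F (z.2, b) - F (a, b)))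
        (b, ζ) := by
      have e1 : ContinuousAt (fun z : ℂ × ℂ => F (z.2, z.1)) (b, ζ) :=
        ContinuousAt.comp (f := fun z : ℂ × ℂ => (z.2, z.1)) (x := (b, ζ)) (hFat _ hζb)
          (by fun_prop)
      have e2 : ContinuousAt (fun z : ℂ × ℂ => F (a, z.1)) (b, ζ) :=
        ContinuousAt.comp (f := fun z : ℂ × ℂ => (a, z.1)) (x := (b, ζ)) (hFat _ hab)
          (by fun_prop)
      have e3 : ContinuousAt (fun z : ℂ × ℂ => F (z.2, b)) (b, ζ) :=
        ContinuousAt.comp (f := fun z : ℂ × ℂ => (z.2, b)) (x := (b, ζ)) (hFat _ hζb)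
          (by fun_prop)
      have e4 : ContinuousAt (fun z : ℂ × ℂ => (z.2 - a)⁻¹) (b, ζ) :=
        ContinuousAt.inv₀ (by fun_prop) (sub_ne_zero.2 hζa)
      exact (e4.mul (e1.sub e2)).sub (e4.mul (e3.sub continuousAt_const))
    have hlim := hcont.norm.eventually_lt_const (u := ε) (by simpa using hε)
    have hne : ∀ᶠ z : ℂ × ℂ in 𝓝 (b, ζ), z.2 ≠ a :=
      continuousAt_snd.eventually_ne hζa
    filter_upwards [hlim, hne] with z hz hza
    simpa [hD, dslope_of_ne _ hza, slope_def_module] using hz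
  have hDc : ContinuousAt (fun z : ℂ × ℂ => D z.2 z.1) (a, b) := by
    rw [Metric.continuousAt_iff']
    intro ε hε
    have hDb : ContinuousAt (fun z : ℂ × ℂ => D b z.1) (a, b) :=
      ContinuousAt.comp (f := fun z : ℂ × ℂ => z.1) (x := (a, b))
        ((hDd b hb).continuousOn.continuousAt (Metric.closedBall_mem_nhds a hR)) continuousAt_fst
    have e1 := Metric.continuousAt_iff'.1 hDb (ε / 2) (half_pos hε)
    have e2 : ∀ᶠ z : ℂ × ℂ in 𝓝 (a, b), ∀ ζ ∈ Metric.sphere a R, ‖D z.2 ζ - D b ζ‖ < ε / 2 :=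
      (continuousAt_snd (p := (a, b))).eventually (hcirc (ε / 2) (half_pos hε))
    have e3 : ∀ᶠ z : ℂ × ℂ in 𝓝 (a, b), z.2 ∈ Metric.closedBall b R :=
      continuousAt_snd.eventually (Metric.closedBall_mem_nhds b hR)
    have e4 : ∀ᶠ z : ℂ × ℂ in 𝓝 (a, b), z.1 ∈ Metric.closedBall a R :=
      continuousAt_fst.eventually (Metric.closedBall_mem_nhds a hR)
    filter_upwards [e1, e2, e3, e4] with z hz1 hz2 hz3 hz4
    have hmax : ‖D z.2 z.1 - D b z.1‖ ≤ ε / 2 := by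
      have hdc : DiffContOnCl ℂ (fun u => D z.2 u - D b u) (Metric.ball a R) :=
        ((hDd _ hz3).sub (hDd b hb)).diffContOnCl_ball subset_rfl
      refine Complex.norm_le_of_forall_mem_frontier_norm_le (f := fun u => D z.2 u - D b u)
        Metric.isBounded_ball hdc (fun w hw => ?_) (z := z.1) ?_
      · rw [frontier_ball a hR.ne'] at hw
        exact (hz2 w hw).le
      · rwa [closure_ball a hR.ne']
    rw [dist_eq_norm] at hz1 ⊢
    calc ‖D z.2 z.1 - D b a‖ = ‖(D z.2 z.1 - D b z.1) + (D b z.1 - D b a)‖ := by ring_nf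
      _ ≤ ‖D z.2 z.1 - D b z.1‖ + ‖D b z.1 - D b a‖ := norm_add_le _ _
      _ < ε := by linarith
  have hprod : HasFDerivAt (fun z : ℂ × ℂ => (z.1 - a) * D z.2 z.1)
      (D b a • ContinuousLinearMap.fst ℂ ℂ ℂ) (a, b) := by
    rw [hasFDerivAt_iff_isLittleO]
    have e1 : (fun z : ℂ × ℂ => z.1 - a) =O[𝓝 (a, b)] fun z => z - (a, b) :=
      Asymptotics.isBigO_of_le _ fun z => norm_fst_le (z - (a, b))
    have e2 : (fun z : ℂ × ℂ => D z.2 z.1 - D b a) =o[𝓝 (a, b)] fun _ => (1 : ℂ) := by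
      rw [Asymptotics.isLittleO_one_iff]
      have e3 := Tendsto.sub_const hDc (D b a)
      rwa [sub_self] at e3
    have e4 := e2.smul_isBigO e1
    simp only [one_smul] at e4
    refine e4.congr_left fun z => ?_
    simp
    ring
  have hFa : DifferentiableAt ℂ (fun z : ℂ × ℂ => F (a, z.2)) (a, b) :=
    DifferentiableAt.comp (f := fun z : ℂ × ℂ => z.2) (a, b) (h2 (a, b) hab) differentiableAt_snd
  exact (hFa.add hprod.differentiableAt).congr_of_eventuallyEq
    (Eventually.of_forall fun z => hDs z.1 z.2)

/-- Holomorphy descends along `z ↦ z ^ n`: away from `0` by a local `n`-th root, and at `0` by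
removability of the singularity of a continuous function. -/
theorem differentiableOn_of_comp_pow {h : ℂ → ℂ} {n : ℕ} (hn : n ≠ 0) {O : Set ℂ} (hO : IsOpen O)
    (H : ∀ z : ℂ, z ^ n ∈ O → DifferentiableAt ℂ (fun z => h (z ^ n)) z) :
    DifferentiableOn ℂ h O := by
  have hne : ∀ u ∈ O, u ≠ 0 → DifferentiableAt ℂ h u := by
    intro u hu hu0
    set z₀ : ℂ := u ^ ((n : ℂ)⁻¹) with hz₀
    have hz₀n : z₀ ^ n = u := Complex.cpow_nat_inv_pow u hn
    set g : ℂ → ℂ := fun v => z₀ * (v / u) ^ ((n : ℂ)⁻¹) with hg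
    have hgn : ∀ v, g v ^ n = v := by
      intro v
      rw [hg]
      simp only [mul_pow, hz₀n, Complex.cpow_nat_inv_pow _ hn]
      field_simp
    have hgd : DifferentiableAt ℂ g u := by
      apply DifferentiableAt.const_mul
      apply DifferentiableAt.cpow_const
      · fun_prop
      · simp [hu0]
    have h3 : DifferentiableAt ℂ (fun z => h (z ^ n)) (g u) := H _ (by rwa [hgn])
    have := h3.comp u hgd
    refine this.congr_of_eventuallyEq (Eventually.of_forall fun v => ?_)
    simp [hgn]
  by_cases h0 : (0 : ℂ) ∈ O
  · rw [← Complex.differentiableOn_compl_singleton_and_continuousAt_iff (hO.mem_nhds h0)]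
    refine ⟨fun u hu => (hne u hu.1 hu.2).differentiableWithinAt, ?_⟩
    have hr : ContinuousAt (fun u : ℂ => u ^ ((n : ℂ)⁻¹)) 0 := by
      apply Complex.continuousAt_cpow_const_of_re_pos
      · simp
      · rw [← Complex.ofReal_natCast, ← Complex.ofReal_inv, Complex.ofReal_re]
        positivity
    have h3 : ContinuousAt (fun z => h (z ^ n)) ((0 : ℂ) ^ ((n : ℂ)⁻¹)) :=
      (H _ (by rwa [Complex.cpow_nat_inv_pow _ hn])).continuousAt
    have h4 := ContinuousAt.comp (f := fun u : ℂ => u ^ ((n : ℂ)⁻¹)) (x := (0 : ℂ)) h3 hr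
    refine h4.congr (Eventually.of_forall fun v => ?_)
    simp [Complex.cpow_nat_inv_pow _ hn]
  · exact fun u hu => (hne u hu (by rintro rfl; exact h0 hu)).differentiableWithinAt

/-! ### The invariant coordinate at a point -/

section LocalQuotient

variable {C : Type*} [TopologicalSpace C] [ChartedSpace ℂ C]

theorem HolAut.continuous {g : Equiv.Perm C} (hg : g ∈ HolAut C) : Continuous g :=
  hg.1.continuous

/-- A permutation expressed in the preferred chart at `p`, on the source and on the target. -/
noncomputable def coordRep (p : C) (g : Equiv.Perm C) : ℂ → ℂ :=
  fun u => chartAt ℂ p (g ((chartAt ℂ p).symm u))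

variable [IsManifold 𝓘(ℂ, ℂ) ω C]

theorem mdifferentiableAt_chart_comp {p x : C} {g : Equiv.Perm C} (hg : g ∈ HolAut C)
    (hx : g x ∈ (chartAt ℂ p).source) :
    MDifferentiableAt 𝓘(ℂ, ℂ) 𝓘(ℂ, ℂ) (fun y => chartAt ℂ p (g y)) x := by
  have : IsManifold 𝓘(ℂ, ℂ) 1 C := IsManifold.of_le (n := ω) le_top
  exact (mdifferentiableAt_atlas (chart_mem_atlas ℂ p) hx).comp x (hg.1 x)

theorem differentiableAt_coordRep {p : C} {g : Equiv.Perm C} (hg : g ∈ HolAut C) {u : ℂ}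
    (hu : u ∈ (chartAt ℂ p).target) (hgu : g ((chartAt ℂ p).symm u) ∈ (chartAt ℂ p).source) :
    DifferentiableAt ℂ (coordRep p g) u := by
  have : IsManifold 𝓘(ℂ, ℂ) 1 C := IsManifold.of_le (n := ω) le_top
  rw [← mdifferentiableAt_iff_differentiableAt]
  exact (mdifferentiableAt_chart_comp hg hgu).comp u
    (mdifferentiableAt_atlas_symm (chart_mem_atlas ℂ p) hu)

/-- The derivative at `p` of the automorphisms fixing `p` is a character of the stabilizer. -/
noncomputable def stabilizerChar (Γ : Subgroup (Equiv.Perm C)) (hΓ : Γ ≤ HolAut C) (p : C) :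
    MulAction.stabilizer Γ p →* ℂ where
  toFun s := deriv (coordRep p (s : Γ)) (chartAt ℂ p p)
  map_one' := by
    have h : coordRep p ((1 : MulAction.stabilizer Γ p) : Γ) =ᶠ[𝓝 (chartAt ℂ p p)] id := by
      filter_upwards [(chartAt ℂ p).open_target.mem_nhds
        ((chartAt ℂ p).map_source (mem_chart_source ℂ p))] with u hu
      simp [coordRep, (chartAt ℂ p).right_inv hu]
    rw [h.deriv_eq, deriv_id]
  map_mul' s t := by
    have hfix : ∀ s : MulAction.stabilizer Γ p, ((s : Γ) : Equiv.Perm C) p = p := fun s => s.2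
    have hp := mem_chart_source ℂ p
    have hl := (chartAt ℂ p).left_inv hp
    have hz := (chartAt ℂ p).map_source hp
    have hd : ∀ s : MulAction.stabilizer Γ p,
        DifferentiableAt ℂ (coordRep p (s : Γ)) (chartAt ℂ p p) := fun s =>
      differentiableAt_coordRep (hΓ (s : Γ).2) hz (by rw [hl, hfix]; exact hp)
    have hc : coordRep p (t : Γ) (chartAt ℂ p p) = chartAt ℂ p p := by
      simp only [coordRep, hl, hfix]
    have h : coordRep p ((s * t : MulAction.stabilizer Γ p) : Γ) =ᶠ[𝓝 (chartAt ℂ p p)]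
        coordRep p (s : Γ) ∘ coordRep p (t : Γ) := by
      have hct : ContinuousAt (fun u => ((t : Γ) : Equiv.Perm C) ((chartAt ℂ p).symm u))
          (chartAt ℂ p p) :=
        (HolAut.continuous (hΓ (t : Γ).2)).continuousAt.comp
          ((chartAt ℂ p).continuousAt_symm hz)
      have hev := hct.eventually_mem (s := (chartAt ℂ p).source) (by
        rw [hl, hfix]
        exact (chartAt ℂ p).open_source.mem_nhds hp)
      filter_upwards [hev] with u hu
      simp [coordRep, (chartAt ℂ p).left_inv hu]
    rw [h.deriv_eq, deriv_comp _ (by rw [hc]; exact hd s) (hd t), hc]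

/-- The function `φ ^ n` separates the orbits of `Γ` near `p`. The coordinate `φ` is the average of
`χ(s)⁻¹ (z ∘ s - z(p))` over the stabilizer of `p`, on which the stabilizer acts by its character
`χ`; the image of `χ` is the group of `n`-th roots of unity. -/
theorem exists_coord_pow_eq_iff [T2Space C] (Γ : Subgroup (Equiv.Perm C)) [Finite Γ]
    (hΓ : Γ ≤ HolAut C) (p : C) :
    ∃ (φ : OpenPartialHomeomorph C ℂ) (n : ℕ) (r : ℝ), n ≠ 0 ∧ 0 < r ∧ p ∈ φ.source ∧
      φ.target = Metric.ball 0 r ∧ MDifferentiableOn 𝓘(ℂ, ℂ) 𝓘(ℂ, ℂ) φ φ.source ∧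
      MDifferentiableOn 𝓘(ℂ, ℂ) 𝓘(ℂ, ℂ) φ.symm φ.target ∧
      ∀ x ∈ φ.source, ∀ y ∈ φ.source, (∃ γ ∈ Γ, γ x = y) ↔ φ x ^ n = φ y ^ n := by
  have : IsManifold 𝓘(ℂ, ℂ) 1 C := IsManifold.of_le (n := ω) le_top
  classical
  let S := MulAction.stabilizer Γ p
  have : Fintype S := Fintype.ofFinite S
  let χ : S →* ℂ := stabilizerChar Γ hΓ p
  set z := chartAt ℂ p
  have hp : p ∈ z.source := mem_chart_source ℂ p
  have hzp : z p ∈ z.target := z.map_source hp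
  have hl : z.symm (z p) = p := z.left_inv hp
  let act : S → C → C := fun s x => ((s : Γ) : Equiv.Perm C) x
  have hfix : ∀ s : S, act s p = p := fun s => s.2
  have hactc : ∀ s : S, Continuous (act s) := fun s => HolAut.continuous (hΓ (s : Γ).2)
  -- the equivariance of the average `w` holds on all of `C`, as `z` is a total function
  let w : C → ℂ := fun x => (Fintype.card S : ℂ)⁻¹ * ∑ s : S, χ s⁻¹ * (z (act s x) - z p)
  have hwp : w p = 0 := by simp [w, hfix]
  have hwt : ∀ (t : S) (x : C), w (act t x) = χ t * w x := by
    intro t x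
    have h : ∑ s : S, χ s⁻¹ * (z (act s (act t x)) - z p) =
        ∑ s : S, χ (s * t⁻¹)⁻¹ * (z (act s x) - z p) := by
      refine Fintype.sum_equiv (Equiv.mulRight t) _ _ fun s => ?_
      simp [act]
    have h' : ∑ s : S, χ (s * t⁻¹)⁻¹ * (z (act s x) - z p) =
        χ t * ∑ s : S, χ s⁻¹ * (z (act s x) - z p) := by
      rw [Finset.mul_sum]
      refine Finset.sum_congr rfl fun s _ => ?_
      rw [mul_inv_rev, inv_inv, map_mul, mul_assoc]
    change (Fintype.card S : ℂ)⁻¹ * _ = _ * ((Fintype.card S : ℂ)⁻¹ * _)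
    rw [h, h']
    ring
  let W : ℂ → ℂ := fun u => w (z.symm u)
  have hWz : ∀ x ∈ z.source, W (z x) = w x := fun x hx => by simp only [W, z.left_inv hx]
  have hWd : ∀ u ∈ z.target, (∀ s : S, act s (z.symm u) ∈ z.source) →
      DifferentiableAt ℂ W u := by
    intro u hu hus
    refine DifferentiableAt.const_mul (DifferentiableAt.fun_sum fun s _ => ?_) _
    exact ((differentiableAt_coordRep (hΓ (s : Γ).2) hu (hus s)).sub_const _).const_mul _
  have hW1 : HasDerivAt W 1 (z p) := by
    have h : ∀ s : S, HasDerivAt (fun u => χ s⁻¹ * (z (act s (z.symm u)) - z p)) (χ s⁻¹ * χ s)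
        (z p) := fun s =>
      ((differentiableAt_coordRep (hΓ (s : Γ).2) hzp
        (by rw [hl]; change act s p ∈ _; rw [hfix]; exact hp)).hasDerivAt.sub_const _).const_mul _
    have h2 := (HasDerivAt.fun_sum fun (s : S) (_ : s ∈ Finset.univ) => h s).const_mul
      (Fintype.card S : ℂ)⁻¹
    have hχ : ∀ s : S, χ s⁻¹ * χ s = 1 := fun s => by rw [← map_mul, inv_mul_cancel, map_one]
    have h3 : (Fintype.card S : ℂ)⁻¹ * ∑ s : S, χ s⁻¹ * χ s = 1 := by
      rw [Finset.sum_congr rfl fun s _ => hχ s]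
      simp
    rwa [h3] at h2
  have hact_mem : ∀ V ∈ 𝓝 p, ∀ᶠ x in 𝓝 p, ∀ s : S, act s x ∈ V := fun V hV =>
    eventually_all.2 fun s => (hactc s).continuousAt.eventually_mem (by rwa [hfix s])
  have hz_tendsto : Tendsto z.symm (𝓝 (z p)) (𝓝 p) := by
    have := z.continuousAt_symm hzp
    rwa [ContinuousAt, hl] at this
  have hWan : AnalyticAt ℂ W (z p) := by
    rw [Complex.analyticAt_iff_eventually_differentiableAt]
    filter_upwards [z.open_target.mem_nhds hzp,
      hz_tendsto.eventually (hact_mem _ (z.open_source.mem_nhds hp))] with u hu hus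
    exact hWd u hu hus
  have hWs : HasStrictDerivAt W 1 (z p) := by
    have := hWan.hasStrictDerivAt
    rwa [hW1.deriv] at this
  -- the local inverse of the averaged coordinate
  have hWf := hWs.hasStrictFDerivAt_equiv one_ne_zero
  let e : OpenPartialHomeomorph ℂ ℂ := hWf.toOpenPartialHomeomorph W
  have heW : ∀ u, e u = W u := fun u => rfl
  have hes : z p ∈ e.source := hWf.mem_toOpenPartialHomeomorph_source
  have hWzp : W (z p) = 0 := by rw [hWz p hp, hwp]
  have het : (0 : ℂ) ∈ e.target := by
    rw [← hWzp]
    exact e.map_source hes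
  have he0 : e.symm 0 = z p := by rw [← hWzp, ← heW, e.left_inv hes]
  have hesymm : ∀ᶠ u in 𝓝 (0 : ℂ), DifferentiableAt ℂ e.symm u := by
    have h : ContDiffAt ℂ ω e.symm 0 :=
      e.contDiffAt_symm_deriv one_ne_zero het (by rw [he0]; exact hW1)
        (by rw [he0]; exact hWan.contDiffAt)
    exact Complex.analyticAt_iff_eventually_differentiableAt.1 h.analyticAt
  let φ₀ : OpenPartialHomeomorph C ℂ := z.trans e
  have hφ₀w : ∀ x ∈ φ₀.source, φ₀ x = w x := fun x hx => hWz x hx.1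
  have hpφ₀ : p ∈ φ₀.source := ⟨hp, hes⟩
  have hφ₀p : φ₀ p = 0 := by rw [hφ₀w p hpφ₀, hwp]
  have h0φ₀ : (0 : ℂ) ∈ φ₀.target := hφ₀p ▸ φ₀.map_source hpφ₀
  have hφ₀0 : φ₀.symm 0 = p := by rw [← hφ₀p, φ₀.left_inv hpφ₀]
  -- a neighbourhood moved off itself by the elements not fixing `p`
  have hsep : ∃ N ∈ 𝓝 p, ∀ γ ∈ Γ, γ p ≠ p → ∀ x ∈ N, γ x ∉ N := by
    have h : ∀ γ : Γ, ∃ N ∈ 𝓝 p, (γ : Equiv.Perm C) p ≠ p →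
        ∀ x ∈ N, (γ : Equiv.Perm C) x ∉ N := by
      intro γ
      by_cases hγ : (γ : Equiv.Perm C) p = p
      · exact ⟨Set.univ, univ_mem, fun h => absurd hγ h⟩
      · obtain ⟨A, B, hA, hB, hpA, hpB, hAB⟩ := t2_separation hγ
        refine ⟨B ∩ (γ : Equiv.Perm C) ⁻¹' A, inter_mem (hB.mem_nhds hpB)
          ((HolAut.continuous (hΓ γ.2)).continuousAt.preimage_mem_nhds (hA.mem_nhds hpA)),
          fun _ x hx hx' => ?_⟩
        exact Set.disjoint_left.1 hAB hx.2 hx'.1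
    choose N hN hN' using h
    exact ⟨⋂ γ, N γ, iInter_mem.2 hN, fun γ hγ hp' x hx hx' =>
      hN' ⟨γ, hγ⟩ hp' x (Set.mem_iInter.1 hx _) (Set.mem_iInter.1 hx' _)⟩
  obtain ⟨N, hN, hNγ⟩ := hsep
  have hφ₀_tendsto : Tendsto φ₀.symm (𝓝 0) (𝓝 p) := by
    have := φ₀.continuousAt_symm h0φ₀
    rwa [ContinuousAt, hφ₀0] at this
  have hev : ∀ᶠ u in 𝓝 (0 : ℂ), u ∈ φ₀.target ∧ φ₀.symm u ∈ N ∧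
      (∀ s : S, act s (φ₀.symm u) ∈ φ₀.source) ∧ DifferentiableAt ℂ e.symm u :=
    (φ₀.open_target.eventually_mem h0φ₀).and ((hφ₀_tendsto.eventually hN).and
      ((hφ₀_tendsto.eventually (hact_mem _ (φ₀.open_source.mem_nhds hpφ₀))).and hesymm))
  obtain ⟨r, hr, hball⟩ := Metric.eventually_nhds_iff_ball.1 hev
  let φ : OpenPartialHomeomorph C ℂ :=
    (φ₀.symm.restrOpen (Metric.ball 0 r) Metric.isOpen_ball).symm
  have hφ : ∀ x, φ x = φ₀ x := fun x => rfl
  have hsrc : φ.source = φ₀.source ∩ φ₀ ⁻¹' Metric.ball 0 r := by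
    simp [φ]
  have htgt : φ.target = Metric.ball 0 r := by
    simp only [φ, OpenPartialHomeomorph.symm_target, OpenPartialHomeomorph.restrOpen_source,
      OpenPartialHomeomorph.symm_source]
    exact Set.inter_eq_right.2 fun u hu => (hball u hu).1
  have hx_good : ∀ x ∈ φ.source, x ∈ φ₀.source ∧ φ₀ x ∈ Metric.ball 0 r ∧ x ∈ N ∧
      ∀ s : S, act s x ∈ φ₀.source := by
    intro x hx
    rw [hsrc] at hx
    have h := hball _ hx.2
    rw [φ₀.left_inv hx.1] at h
    exact ⟨hx.1, hx.2, h.2.1, h.2.2.1⟩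
  -- `n` is the order of the image of `χ`, which may be smaller than the order of the stabilizer:
  -- elements in the kernel of `χ` act trivially near `p`
  let n := Nat.card χ.toHomUnits.range
  have hn : n ≠ 0 := Nat.card_pos.ne'
  have hrange : χ.toHomUnits.range = rootsOfUnity n ℂ := by
    have : NeZero n := ⟨hn⟩
    have hle : χ.toHomUnits.range ≤ rootsOfUnity n ℂ := by
      intro ζ hζ
      rw [mem_rootsOfUnity]
      exact congrArg Subtype.val (pow_card_eq_one' (x := (⟨ζ, hζ⟩ : χ.toHomUnits.range)))
    exact Subgroup.eq_of_le_of_card_ge hle (card_rootsOfUnity ℂ n)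
  have hχn : ∀ s : S, χ s ^ n = 1 := by
    intro s
    have h : χ.toHomUnits s ∈ rootsOfUnity n ℂ := hrange ▸ ⟨s, rfl⟩
    rw [mem_rootsOfUnity, Units.ext_iff] at h
    simpa using h
  have hχsurj : ∀ ζ : ℂ, ζ ^ n = 1 → ∃ s : S, χ s = ζ := by
    intro ζ hζ
    let ζ' : ℂˣ := Units.ofPowEqOne ζ n hζ hn
    have h : ζ' ∈ χ.toHomUnits.range := by
      rw [hrange, mem_rootsOfUnity]
      exact Units.ext hζ
    obtain ⟨s, hs⟩ := h
    exact ⟨s, congrArg Units.val hs⟩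
  refine ⟨φ, n, r, hn, hr, ?_, htgt, ?_, ?_, ?_⟩
  · rw [hsrc]
    exact ⟨hpφ₀, by simpa [hφ₀p] using hr⟩
  · intro x hx
    obtain ⟨hx1, -, -, hx4⟩ := hx_good x hx
    have hzx : x ∈ z.source := hx1.1
    apply MDifferentiableAt.mdifferentiableWithinAt
    have h1 : MDifferentiableAt 𝓘(ℂ, ℂ) 𝓘(ℂ, ℂ) W (z x) := by
      rw [mdifferentiableAt_iff_differentiableAt]
      refine hWd _ (z.map_source hzx) fun s => ?_
      rw [z.left_inv hzx]
      exact (hx4 s).1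
    exact h1.comp x (mdifferentiableAt_atlas (chart_mem_atlas ℂ p) hzx)
  · intro u hu
    rw [htgt] at hu
    obtain ⟨hu1, -, -, hu4⟩ := hball u hu
    apply MDifferentiableAt.mdifferentiableWithinAt
    have h1 : MDifferentiableAt 𝓘(ℂ, ℂ) 𝓘(ℂ, ℂ) z.symm (e.symm u) :=
      mdifferentiableAt_atlas_symm (chart_mem_atlas ℂ p) (by
        have := hu1
        simp only [φ₀, OpenPartialHomeomorph.trans_target] at this
        exact this.2)
    exact h1.comp u (mdifferentiableAt_iff_differentiableAt.2 hu4)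
  · intro x hx y hy
    obtain ⟨hx1, hx2, hx3, hx4⟩ := hx_good x hx
    obtain ⟨hy1, hy2, hy3, hy4⟩ := hx_good y hy
    rw [hφ, hφ, hφ₀w x hx1, hφ₀w y hy1]
    constructor
    · rintro ⟨γ, hγ, rfl⟩
      have hγp : γ p = p := by
        by_contra h
        exact hNγ γ hγ h x hx3 hy3
      let s : S := ⟨⟨γ, hγ⟩, MulAction.mem_stabilizer_iff.2 hγp⟩
      have h : w (γ x) = χ s * w x := hwt s x
      have h' : w (γ x) ^ n = w x ^ n := by rw [h, mul_pow, hχn s, one_mul]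
      exact h'.symm
    · intro h
      obtain ⟨s, hs⟩ : ∃ s : S, χ s * w x = w y := by
        by_cases h0 : w x = 0
        · refine ⟨1, ?_⟩
          rw [h0, zero_pow hn] at h
          rw [h0, mul_zero, eq_comm, ← pow_eq_zero_iff hn, ← h]
        · obtain ⟨s, hs⟩ := hχsurj (w y / w x) (by
            rw [div_pow, ← h, div_self (pow_ne_zero _ h0)])
          exact ⟨s, by rw [hs, div_mul_cancel₀ _ h0]⟩
      refine ⟨(s : Γ), (s : Γ).2, ?_⟩
      have hsx : φ₀ (act s x) = φ₀ y := by
        rw [hφ₀w _ (hx4 s), hφ₀w y hy1, hwt, hs]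
      exact φ₀.injOn (hx4 s) hy1 hsx

end LocalQuotient

/-! ### The quotient of a Riemann surface by a finite group -/

section OrbitMap

theorem orbitMk_eq_iff {M : Type*} {Γ : Subgroup (Equiv.Perm M)} {x y : M} :
    orbitMk Γ x = orbitMk Γ y ↔ ∃ γ ∈ Γ, γ x = y := by
  rw [eq_comm]
  constructor
  · intro h
    obtain ⟨γ, hγ⟩ := Quotient.exact h
    exact ⟨γ, γ.2, hγ⟩
  · rintro ⟨γ, hγ, h⟩
    exact Quotient.sound ⟨⟨γ, hγ⟩, h⟩

theorem orbitMk_apply {M : Type*} {Γ : Subgroup (Equiv.Perm M)} {γ : Equiv.Perm M} (hγ : γ ∈ Γ)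
    (x : M) : orbitMk Γ (γ x) = orbitMk Γ x :=
  (orbitMk_eq_iff.2 ⟨γ, hγ, rfl⟩).symm

theorem orbitMk_surjective {M : Type*} (Γ : Subgroup (Equiv.Perm M)) :
    Function.Surjective (orbitMk Γ) :=
  Quotient.mk_surjective

theorem isOpenQuotientMap_orbitMk {M : Type*} [TopologicalSpace M] (Γ : Subgroup (Equiv.Perm M))
    (hΓ : ∀ γ ∈ Γ, Continuous γ) : IsOpenQuotientMap (orbitMk Γ) := by
  have : ContinuousConstSMul Γ M := ⟨fun γ => hΓ γ γ.2⟩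
  exact MulAction.isOpenQuotientMap_quotientMk

end OrbitMap

theorem isOpenMap_complex_pow {n : ℕ} (hn : n ≠ 0) : IsOpenMap fun z : ℂ => z ^ n := by
  have h : AnalyticOnNhd ℂ (fun z : ℂ => z ^ n) Set.univ := fun z _ => analyticAt_id.pow n
  refine h.is_constant_or_isOpenMap.resolve_left ?_
  rintro ⟨w, hw⟩
  have h0 := hw 0
  have h1 := hw 1
  simp only [zero_pow hn, one_pow] at h0 h1
  exact zero_ne_one (h0.trans h1.symm)

section QuotientCharts

variable {C : Type*} [TopologicalSpace C] [ChartedSpace ℂ C]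

/-- A chart of `C / Γ` compatible with the quotient structure: it pulls back to a holomorphic
function on `C`, and functions whose pullback to `C` is holomorphic are holomorphic in it. -/
def IsQuotientChart (Γ : Subgroup (Equiv.Perm C)) (ψ : OpenPartialHomeomorph (OrbitSpace Γ) ℂ) :
    Prop :=
  (∀ x, orbitMk Γ x ∈ ψ.source →
    MDifferentiableAt 𝓘(ℂ, ℂ) 𝓘(ℂ, ℂ) (fun y => ψ (orbitMk Γ y)) x) ∧
  ∀ (O : Set ℂ) (f : OrbitSpace Γ → ℂ), IsOpen O → O ⊆ ψ.target →
    (∀ x, orbitMk Γ x ∈ ψ.source → ψ (orbitMk Γ x) ∈ O →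
      MDifferentiableAt 𝓘(ℂ, ℂ) 𝓘(ℂ, ℂ) (fun y => f (orbitMk Γ y)) x) →
    DifferentiableOn ℂ (fun u => f (ψ.symm u)) O

/-- With the coordinate `φ` of `exists_coord_pow_eq_iff`, the map `[x] ↦ φ x ^ n` is a chart of
`C / Γ`. -/
theorem exists_isQuotientChart [IsManifold 𝓘(ℂ, ℂ) ω C] [T2Space C]
    (Γ : Subgroup (Equiv.Perm C)) [Finite Γ] (hΓ : Γ ≤ HolAut C) (q : OrbitSpace Γ) :
    ∃ ψ : OpenPartialHomeomorph (OrbitSpace Γ) ℂ, q ∈ ψ.source ∧ IsQuotientChart Γ ψ := by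
  obtain ⟨p, rfl⟩ := orbitMk_surjective Γ q
  obtain ⟨φ, n, r, hn, hr, hp, htgt, hφ, hφs, hφn⟩ := exists_coord_pow_eq_iff Γ hΓ p
  have hπ : IsOpenQuotientMap (orbitMk Γ) :=
    isOpenQuotientMap_orbitMk Γ fun γ hγ => (hΓ hγ).1.continuous
  have hne : Nonempty C := ⟨p⟩
  have hroot : ∀ u ∈ Metric.ball (0 : ℂ) (r ^ n), u ^ ((n : ℂ)⁻¹) ∈ φ.target := by
    intro u hu
    rw [htgt, mem_ball_zero_iff]
    rw [mem_ball_zero_iff] at hu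
    refine lt_of_pow_lt_pow_left₀ n hr.le ?_
    rwa [← norm_pow, Complex.cpow_nat_inv_pow u hn]
  let F : OrbitSpace Γ → ℂ := fun q => φ (Function.invFunOn (orbitMk Γ) φ.source q) ^ n
  have hF : ∀ x ∈ φ.source, F (orbitMk Γ x) = φ x ^ n := by
    intro x hx
    have h : ∃ y ∈ φ.source, orbitMk Γ y = orbitMk Γ x := ⟨x, hx, rfl⟩
    exact (hφn _ (Function.invFunOn_mem h) x hx).1 (orbitMk_eq_iff.1 (Function.invFunOn_eq h))
  have hpow : ∀ u ∈ φ.target, F (orbitMk Γ (φ.symm u)) = u ^ n := by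
    intro u hu
    rw [hF _ (φ.map_target hu), φ.right_inv hu]
  let E : PartialEquiv (OrbitSpace Γ) ℂ :=
    { toFun := F
      invFun := fun u => orbitMk Γ (φ.symm (u ^ ((n : ℂ)⁻¹)))
      source := orbitMk Γ '' φ.source
      target := Metric.ball 0 (r ^ n)
      map_source' := by
        rintro _ ⟨x, hx, rfl⟩
        have hx' := φ.map_source hx
        rw [htgt, mem_ball_zero_iff] at hx'
        rw [hF x hx, mem_ball_zero_iff, norm_pow]
        exact pow_lt_pow_left₀ hx' (norm_nonneg _) hn
      map_target' := fun u hu => ⟨_, φ.map_target (hroot u hu), rfl⟩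
      left_inv' := by
        rintro _ ⟨x, hx, rfl⟩
        have hu : F (orbitMk Γ x) ∈ Metric.ball (0 : ℂ) (r ^ n) := by
          have hx' := φ.map_source hx
          rw [htgt, mem_ball_zero_iff] at hx'
          rw [hF x hx, mem_ball_zero_iff, norm_pow]
          exact pow_lt_pow_left₀ hx' (norm_nonneg _) hn
        rw [orbitMk_eq_iff]
        refine (hφn _ (φ.map_target (hroot _ hu)) x hx).2 ?_
        rw [φ.right_inv (hroot _ hu), Complex.cpow_nat_inv_pow _ hn, hF x hx]
      right_inv' := fun u hu => by
        rw [hpow _ (hroot u hu), Complex.cpow_nat_inv_pow _ hn] }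
  have hsrc : IsOpen E.source := hπ.isOpenMap _ φ.open_source
  have hcont : ContinuousOn E E.source := by
    rintro _ ⟨x, hx, rfl⟩
    apply ContinuousAt.continuousWithinAt
    rw [ContinuousAt, ← hπ.map_nhds_eq, tendsto_map'_iff]
    have h1 : Tendsto (fun y => φ y ^ n) (𝓝 x) (𝓝 (φ x ^ n)) :=
      (φ.continuousAt hx).pow n
    change Tendsto (F ∘ orbitMk Γ) (𝓝 x) (𝓝 (F (orbitMk Γ x)))
    rw [hF x hx]
    refine h1.congr' ?_
    filter_upwards [φ.open_source.mem_nhds hx] with y hy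
    exact (hF y hy).symm
  have hopen : IsOpenMap (E.source.domRestrict E) := by
    intro U hU
    have hU' : IsOpen (Subtype.val '' U) := hsrc.isOpenMap_subtype_val U hU
    have himg : E.source.domRestrict E '' U =
        (fun z : ℂ => z ^ n) '' (φ '' (φ.source ∩ orbitMk Γ ⁻¹' (Subtype.val '' U))) := by
      ext v
      constructor
      · rintro ⟨⟨_, x, hx, rfl⟩, hq, rfl⟩
        exact ⟨_, ⟨x, ⟨hx, _, hq, rfl⟩, rfl⟩, (hF x hx).symm⟩
      · rintro ⟨_, ⟨x, ⟨hx, q, hq, hqx⟩, rfl⟩, rfl⟩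
        refine ⟨q, hq, ?_⟩
        rw [Set.domRestrict_apply, hqx]
        exact hF x hx
    rw [himg]
    exact isOpenMap_complex_pow hn _ (φ.isOpen_image_of_subset_source
      (φ.open_source.inter (hU'.preimage hπ.continuous)) Set.inter_subset_left)
  let ψ : OpenPartialHomeomorph (OrbitSpace Γ) ℂ :=
    OpenPartialHomeomorph.ofContinuousOpenRestrict E hcont hopen hsrc
  have hψF : ∀ q, ψ q = F q := fun q => rfl
  have hψt : ψ.target = Metric.ball 0 (r ^ n) := rfl
  refine ⟨ψ, ⟨p, hp, rfl⟩, ?_, ?_⟩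
  · rintro x ⟨x', hx', hxx'⟩
    obtain ⟨γ, hγ, rfl⟩ := orbitMk_eq_iff.1 hxx'.symm
    have h1 : MDifferentiableAt 𝓘(ℂ, ℂ) 𝓘(ℂ, ℂ) φ (γ x) :=
      (hφ _ hx').mdifferentiableAt (φ.open_source.mem_nhds hx')
    have h2 : MDifferentiableAt 𝓘(ℂ, ℂ) 𝓘(ℂ, ℂ) (fun y => φ (γ y) ^ n) x :=
      ((differentiableAt_pow n).mdifferentiableAt (x := φ (γ x))).comp x (h1.comp x ((hΓ hγ).1 x))
    refine h2.congr_of_eventuallyEq ?_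
    filter_upwards [(hΓ hγ).1.continuous.continuousAt.preimage_mem_nhds
      (φ.open_source.mem_nhds hx')] with y hy
    rw [← orbitMk_apply hγ y]
    exact hF _ hy
  · intro O f hO hOψ hf
    refine differentiableOn_of_comp_pow hn hO fun z hz => ?_
    have hball : ∀ z : ℂ, z ^ n ∈ O → z ∈ φ.target := by
      intro z hz
      have := hOψ hz
      rw [hψt, mem_ball_zero_iff, norm_pow] at this
      rw [htgt, mem_ball_zero_iff]
      exact lt_of_pow_lt_pow_left₀ n hr.le this
    have hsymm : ∀ z ∈ φ.target, ψ.symm (z ^ n) = orbitMk Γ (φ.symm z) := by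
      intro z hz
      rw [← hpow z hz, ← hψF, ψ.left_inv ⟨_, φ.map_target hz, rfl⟩]
    have hzt := hball z hz
    have h1 : MDifferentiableAt 𝓘(ℂ, ℂ) 𝓘(ℂ, ℂ) φ.symm z :=
      (hφs _ hzt).mdifferentiableAt (φ.open_target.mem_nhds hzt)
    have h2 := (hf (φ.symm z) ⟨_, φ.map_target hzt, rfl⟩ (by rwa [hψF, hpow z hzt])).comp z h1
    rw [mdifferentiableAt_iff_differentiableAt] at h2
    refine h2.congr_of_eventuallyEq ?_
    filter_upwards [φ.open_target.mem_nhds hzt] with y hy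
    rw [hsymm y hy]
    rfl

variable [IsManifold 𝓘(ℂ, ℂ) ω C] [T2Space C]

/-- The quotient of a Riemann surface by a finite group of automorphisms, with all the charts
compatible with the quotient structure. -/
@[reducible]
noncomputable def quotientChartedSpace (Γ : Subgroup (Equiv.Perm C)) [Finite Γ]
    (hΓ : Γ ≤ HolAut C) : ChartedSpace ℂ (OrbitSpace Γ) where
  atlas := {ψ | IsQuotientChart Γ ψ}
  chartAt q := (exists_isQuotientChart Γ hΓ q).choose
  mem_chart_source q := (exists_isQuotientChart Γ hΓ q).choose_spec.1
  chart_mem_atlas q := (exists_isQuotientChart Γ hΓ q).choose_spec.2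

theorem isManifold_quotient (Γ : Subgroup (Equiv.Perm C)) [Finite Γ] (hΓ : Γ ≤ HolAut C) :
    letI := quotientChartedSpace Γ hΓ
    IsManifold 𝓘(ℂ, ℂ) ω (OrbitSpace Γ) := by
  let _ := quotientChartedSpace Γ hΓ
  refine isManifold_of_contDiffOn 𝓘(ℂ, ℂ) ω (OrbitSpace Γ) fun e e' he he' => ?_
  have he : IsQuotientChart Γ e := he
  have he' : IsQuotientChart Γ e' := he'
  have h := he.2 (e.symm ≫ₕ e').source e' (e.symm ≫ₕ e').open_source Set.inter_subset_left
    (fun x hx hx' => he'.1 x (by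
      have h' : e.symm (e (orbitMk Γ x)) ∈ e'.source := hx'.2
      rwa [e.left_inv hx] at h'))
  exact (h.contDiffOn (e.symm ≫ₕ e').open_source).mono Set.inter_subset_left

theorem isQuotientStructure_quotient (Γ : Subgroup (Equiv.Perm C)) [Finite Γ]
    (hΓ : Γ ≤ HolAut C) :
    letI := quotientChartedSpace Γ hΓ
    IsQuotientStructure Γ := by
  let _ := quotientChartedSpace Γ hΓ
  have := isManifold_quotient Γ hΓ
  have : IsManifold 𝓘(ℂ, ℂ) 1 (OrbitSpace Γ) := IsManifold.of_le (n := ω) le_top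
  have hπ : IsOpenQuotientMap (orbitMk Γ) :=
    isOpenQuotientMap_orbitMk Γ fun γ hγ => (hΓ hγ).1.continuous
  intro V hV f
  constructor
  · intro hf x hx
    apply MDifferentiableAt.mdifferentiableWithinAt
    have h1 : MDifferentiableAt 𝓘(ℂ, ℂ) 𝓘(ℂ, ℂ) (orbitMk Γ) x := by
      rw [mdifferentiableAt_iff_target]
      refine ⟨hπ.continuous.continuousAt, ?_⟩
      have hch : IsQuotientChart Γ (chartAt ℂ (orbitMk Γ x)) := chart_mem_atlas ℂ (orbitMk Γ x)
      exact hch.1 x (mem_chart_source ℂ _)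
    exact ((hf _ hx).mdifferentiableAt (hV.mem_nhds hx)).comp x h1
  · intro hf q hq
    apply MDifferentiableAt.mdifferentiableWithinAt
    have hch : IsQuotientChart Γ (chartAt ℂ q) := chart_mem_atlas ℂ q
    set ψ := chartAt ℂ q with hψ
    have hqs : q ∈ ψ.source := mem_chart_source ℂ q
    let O : Set ℂ := ψ.target ∩ ψ.symm ⁻¹' V
    have hO : IsOpen O := ψ.isOpen_inter_preimage_symm hV
    have hqO : ψ q ∈ O := ⟨ψ.map_source hqs, by rwa [Set.mem_preimage, ψ.left_inv hqs]⟩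
    have h1 := hch.2 O f hO Set.inter_subset_left (fun x hx hx' => by
      have hxV : orbitMk Γ x ∈ V := by
        have := hx'.2
        rwa [Set.mem_preimage, ψ.left_inv hx] at this
      exact (hf x hxV).mdifferentiableAt ((hV.preimage hπ.continuous).mem_nhds hxV))
    have h2 : MDifferentiableAt 𝓘(ℂ, ℂ) 𝓘(ℂ, ℂ) (fun q' => f (ψ.symm (ψ q'))) q :=
      (h1.differentiableAt (hO.mem_nhds hqO)).mdifferentiableAt.comp q
        (mdifferentiableAt_atlas (chart_mem_atlas ℂ q) hqs)
    refine h2.congr_of_eventuallyEq ?_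
    filter_upwards [ψ.open_source.mem_nhds hqs] with q' hq'
    rw [ψ.left_inv hq']

end QuotientCharts

/-- The quotient of a curve by a finite group of automorphisms is a curve. -/
theorem IsCurve.exists_quotient {C : Type*} [TopologicalSpace C] [ChartedSpace ℂ C]
    (hC : IsCurve C) (Γ : Subgroup (Equiv.Perm C)) [Finite Γ] (hΓ : Γ ≤ HolAut C) :
    ∃ _ : ChartedSpace ℂ (OrbitSpace Γ), IsCurve (OrbitSpace Γ) ∧ IsQuotientStructure Γ := by
  have := hC.isManifold
  have := hC.t2Space
  have := hC.compactSpace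
  have := hC.connectedSpace
  have : ContinuousConstSMul Γ C := ⟨fun γ => (hΓ γ.2).1.continuous⟩
  let _ := quotientChartedSpace Γ hΓ
  refine ⟨quotientChartedSpace Γ hΓ, ⟨isManifold_quotient Γ hΓ, ?_, ?_, ?_⟩,
    isQuotientStructure_quotient Γ hΓ⟩
  · exact t2Space_of_properlyDiscontinuousSMul_of_t2Space
  · exact Quotient.compactSpace
  · have h : ConnectedSpace (Quotient (MulAction.orbitRel Γ C)) := inferInstance
    exact h

/-! ### Holomorphic maps and functions on the quotient -/

/-- Osgood's lemma on a product of two Riemann surfaces. -/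
theorem mdifferentiableOn_of_separately {Q Q' : Type*} [TopologicalSpace Q] [ChartedSpace ℂ Q]
    [IsManifold 𝓘(ℂ, ℂ) ω Q] [TopologicalSpace Q'] [ChartedSpace ℂ Q'] [IsManifold 𝓘(ℂ, ℂ) ω Q']
    {F : Q × Q' → ℂ} {W : Set (Q × Q')} (hW : IsOpen W) (hc : ContinuousOn F W)
    (h1 : ∀ p ∈ W, MDifferentiableAt 𝓘(ℂ, ℂ) 𝓘(ℂ, ℂ) (fun u => F (u, p.2)) p.1)
    (h2 : ∀ p ∈ W, MDifferentiableAt 𝓘(ℂ, ℂ) 𝓘(ℂ, ℂ) (fun v => F (p.1, v)) p.2) :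
    MDifferentiableOn (𝓘(ℂ, ℂ).prod 𝓘(ℂ, ℂ)) 𝓘(ℂ, ℂ) F W := by
  have : IsManifold 𝓘(ℂ, ℂ) 1 Q := IsManifold.of_le (n := ω) le_top
  have : IsManifold 𝓘(ℂ, ℂ) 1 Q' := IsManifold.of_le (n := ω) le_top
  rintro ⟨a, b⟩ hab
  apply MDifferentiableAt.mdifferentiableWithinAt
  let φ := chartAt ℂ a
  let φ' := chartAt ℂ b
  have ha : a ∈ φ.source := mem_chart_source ℂ a
  have hb : b ∈ φ'.source := mem_chart_source ℂ b
  let H : ℂ × ℂ → ℂ := fun z => F (φ.symm z.1, φ'.symm z.2)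
  let O : Set (ℂ × ℂ) := (φ.prod φ').target ∩ (φ.prod φ').symm ⁻¹' W
  have hO : IsOpen O := (φ.prod φ').isOpen_inter_preimage_symm hW
  have hab' : (φ a, φ' b) ∈ O := by
    refine ⟨⟨φ.map_source ha, φ'.map_source hb⟩, ?_⟩
    change (φ.symm (φ a), φ'.symm (φ' b)) ∈ W
    rwa [φ.left_inv ha, φ'.left_inv hb]
  have hH : DifferentiableOn ℂ H O := by
    refine differentiableOn_of_separately hO ?_ ?_ ?_
    · exact hc.comp ((φ.prod φ').continuousOn_symm.mono Set.inter_subset_left) fun z hz => hz.2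
    · rintro ⟨u, v⟩ ⟨⟨hu, hv⟩, huv⟩
      rw [← mdifferentiableAt_iff_differentiableAt]
      exact (h1 _ huv).comp u (mdifferentiableAt_atlas_symm (chart_mem_atlas ℂ a) hu)
    · rintro ⟨u, v⟩ ⟨⟨hu, hv⟩, huv⟩
      rw [← mdifferentiableAt_iff_differentiableAt]
      exact (h2 _ huv).comp v (mdifferentiableAt_atlas_symm (chart_mem_atlas ℂ b) hv)
  have hchart : MDifferentiableAt (𝓘(ℂ, ℂ).prod 𝓘(ℂ, ℂ)) 𝓘(ℂ, ℂ × ℂ)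
      (fun z : Q × Q' => (φ z.1, φ' z.2)) (a, b) := by
    apply MDifferentiableAt.prodMk_space
    · exact (mdifferentiableAt_atlas (chart_mem_atlas ℂ a) ha).comp (a, b) mdifferentiableAt_fst
    · exact (mdifferentiableAt_atlas (chart_mem_atlas ℂ b) hb).comp (a, b) mdifferentiableAt_snd
  have hcomp : MDifferentiableAt (𝓘(ℂ, ℂ).prod 𝓘(ℂ, ℂ)) 𝓘(ℂ, ℂ)
      (fun z : Q × Q' => H (φ z.1, φ' z.2)) (a, b) :=
    MDifferentiableAt.comp (g := H) (f := fun z : Q × Q' => (φ z.1, φ' z.2)) (a, b)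
      (hH.differentiableAt (hO.mem_nhds hab')).mdifferentiableAt hchart
  refine hcomp.congr_of_eventuallyEq ?_
  filter_upwards [(φ.prod φ').open_source.mem_nhds (show (a, b) ∈ _ from ⟨ha, hb⟩)] with z hz
  simp only [H, φ.left_inv hz.1, φ'.left_inv hz.2]

section QuotientStructure

variable {C : Type*} [TopologicalSpace C] [ChartedSpace ℂ C] {Γ : Subgroup (Equiv.Perm C)}
  [ChartedSpace ℂ (OrbitSpace Γ)]

theorem IsQuotientStructure.mdifferentiable_orbitMk [IsManifold 𝓘(ℂ, ℂ) ω (OrbitSpace Γ)]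
    (hQ : IsQuotientStructure Γ) (hπ : IsOpenQuotientMap (orbitMk Γ)) :
    MDifferentiable 𝓘(ℂ, ℂ) 𝓘(ℂ, ℂ) (orbitMk Γ) := by
  have : IsManifold 𝓘(ℂ, ℂ) 1 (OrbitSpace Γ) := IsManifold.of_le (n := ω) le_top
  intro x
  rw [mdifferentiableAt_iff_target]
  refine ⟨hπ.continuous.continuousAt, ?_⟩
  have hV := (chartAt ℂ (orbitMk Γ x)).open_source
  have hx := mem_chart_source ℂ (orbitMk Γ x)
  have h := (hQ _ hV _).1 (mdifferentiableOn_atlas (chart_mem_atlas ℂ (orbitMk Γ x)))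
  exact (h x hx).mdifferentiableAt ((hV.preimage hπ.continuous).mem_nhds hx)

/-- The universal property of the quotient: a map is holomorphic if its pullback is. -/
theorem IsQuotientStructure.mdifferentiable_of_comp {M : Type*} [TopologicalSpace M]
    [ChartedSpace ℂ M] [IsManifold 𝓘(ℂ, ℂ) ω M] (hQ : IsQuotientStructure Γ)
    (hπ : IsOpenQuotientMap (orbitMk Γ)) {f : OrbitSpace Γ → M}
    (hf : MDifferentiable 𝓘(ℂ, ℂ) 𝓘(ℂ, ℂ) fun x => f (orbitMk Γ x)) :
    MDifferentiable 𝓘(ℂ, ℂ) 𝓘(ℂ, ℂ) f := by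
  have : IsManifold 𝓘(ℂ, ℂ) 1 M := IsManifold.of_le (n := ω) le_top
  have hfc : Continuous f := hπ.continuous_comp_iff.1 hf.continuous
  intro q
  rw [mdifferentiableAt_iff_target]
  refine ⟨hfc.continuousAt, ?_⟩
  have hV : IsOpen (f ⁻¹' (chartAt ℂ (f q)).source) :=
    (chartAt ℂ (f q)).open_source.preimage hfc
  have hq : q ∈ f ⁻¹' (chartAt ℂ (f q)).source := mem_chart_source ℂ (f q)
  have h : MDifferentiableOn 𝓘(ℂ, ℂ) 𝓘(ℂ, ℂ) (chartAt ℂ (f q) ∘ f)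
      (f ⁻¹' (chartAt ℂ (f q)).source) := by
    refine (hQ _ hV _).2 fun x hx => ?_
    apply MDifferentiableAt.mdifferentiableWithinAt
    exact MDifferentiableAt.comp (g := chartAt ℂ (f q)) (f := fun x => f (orbitMk Γ x)) x
      (mdifferentiableAt_atlas (chart_mem_atlas ℂ (f q)) hx) (hf x)
  exact (h q hq).mdifferentiableAt (hV.mem_nhds hq)

/-- A function on the square of the quotient is holomorphic if its pullback is: this holds in each
variable separately, and Osgood's lemma applies. -/
theorem IsQuotientStructure.mdifferentiableOn_prod [IsManifold 𝓘(ℂ, ℂ) ω (OrbitSpace Γ)]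
    (hQ : IsQuotientStructure Γ) (hπ : IsOpenQuotientMap (orbitMk Γ))
    {F : OrbitSpace Γ × OrbitSpace Γ → ℂ} {W : Set (OrbitSpace Γ × OrbitSpace Γ)}
    (hW : IsOpen W)
    (hF : ∀ x y : C, (orbitMk Γ x, orbitMk Γ y) ∈ W →
      MDifferentiableAt (𝓘(ℂ, ℂ).prod 𝓘(ℂ, ℂ)) 𝓘(ℂ, ℂ)
        (fun z : C × C => F (orbitMk Γ z.1, orbitMk Γ z.2)) (x, y)) :
    MDifferentiableOn (𝓘(ℂ, ℂ).prod 𝓘(ℂ, ℂ)) 𝓘(ℂ, ℂ) F W := by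
  refine mdifferentiableOn_of_separately hW ?_ ?_ ?_
  · rintro ⟨q, q'⟩ hq
    obtain ⟨x, rfl⟩ := hπ.surjective q
    obtain ⟨y, rfl⟩ := hπ.surjective q'
    apply ContinuousAt.continuousWithinAt
    have h := (hπ.prodMap hπ).map_nhds_eq (x, y)
    change map _ _ = 𝓝 (orbitMk Γ x, orbitMk Γ y) at h
    rw [ContinuousAt, ← h, tendsto_map'_iff]
    exact (hF x y hq).continuousAt
  · rintro ⟨q, q'⟩ hq
    obtain ⟨y, rfl⟩ := hπ.surjective q'
    have hV : IsOpen {q : OrbitSpace Γ | (q, orbitMk Γ y) ∈ W} := hW.preimage (by fun_prop)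
    refine ((hQ _ hV fun q => F (q, orbitMk Γ y)).2 (fun x hx => ?_) q hq).mdifferentiableAt
      (hV.mem_nhds hq)
    apply MDifferentiableAt.mdifferentiableWithinAt
    exact MDifferentiableAt.comp (g := fun z : C × C => F (orbitMk Γ z.1, orbitMk Γ z.2))
      (f := fun x => (x, y)) x (hF x y hx) (mdifferentiableAt_id.prodMk mdifferentiableAt_const)
  · rintro ⟨q, q'⟩ hq
    obtain ⟨x, rfl⟩ := hπ.surjective q
    have hV : IsOpen {q : OrbitSpace Γ | (orbitMk Γ x, q) ∈ W} := hW.preimage (by fun_prop)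
    refine ((hQ _ hV fun q => F (orbitMk Γ x, q)).2 (fun y hy => ?_) q' hq).mdifferentiableAt
      (hV.mem_nhds hq)
    apply MDifferentiableAt.mdifferentiableWithinAt
    exact MDifferentiableAt.comp (g := fun z : C × C => F (orbitMk Γ z.1, orbitMk Γ z.2))
      (f := fun y => (x, y)) y (hF x y hy) (mdifferentiableAt_const.prodMk mdifferentiableAt_id)

end QuotientStructure

/-! ### Generalized dihedral quotients and the factors of a mixed action -/

section DihedralQuotient

variable {G : Type*} [Group G] {H K : Subgroup G}

/-- The squares of `τ γ` and of `τ` lie in `K`, so `τ` inverts `γ` modulo `K`. -/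
theorem conj_mul_mem_of_sq_mem [K.Normal] (hsq : ∀ g ∉ H, g ^ 2 ∈ K) {τ γ : G} (hτ : τ ∉ H)
    (hγ : γ ∈ H) : τ * γ * τ⁻¹ * γ ∈ K := by
  have h1 : (τ * γ) ^ 2 ∈ K := hsq _ fun h => hτ ((H.mul_mem_cancel_right hγ).1 h)
  have h2 : γ⁻¹ * (τ ^ 2)⁻¹ * γ ∈ K := by
    simpa using ‹K.Normal›.conj_mem _ (K.inv_mem (hsq τ hτ)) γ⁻¹
  have h3 : τ * γ * τ⁻¹ * γ = (τ * γ) ^ 2 * (γ⁻¹ * (τ ^ 2)⁻¹ * γ) := by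
    simp only [pow_two]
    group
  rw [h3]
  exact K.mul_mem h1 h2

theorem commutes_quotient_of_commutators_mem [K.Normal]
    (hcomm : ∀ g ∈ H, ∀ h ∈ H, g * h * g⁻¹ * h⁻¹ ∈ K) (a b : H ⧸ K.subgroupOf H) :
    a * b = b * a := by
  obtain ⟨g, rfl⟩ := QuotientGroup.mk_surjective a
  obtain ⟨h, rfl⟩ := QuotientGroup.mk_surjective b
  rw [← QuotientGroup.mk_mul, ← QuotientGroup.mk_mul, QuotientGroup.eq_iff_div_mem,
    Subgroup.mem_subgroupOf]
  have := hcomm g g.2 h h.2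
  simpa [div_eq_mul_inv, mul_assoc] using this

theorem multiplicative_zmod_two_eq (s : Multiplicative (ZMod 2)) :
    s = 1 ∨ s = Multiplicative.ofAdd 1 := by
  revert s
  decide

/-- The homomorphism from `ℤ/2` given by an element of square `1`. -/
def homOfSqEqOne {M : Type*} [Group M] (t : M) (ht : t * t = 1) :
    Multiplicative (ZMod 2) →* M where
  toFun s := if s = 1 then 1 else t
  map_one' := if_pos rfl
  map_mul' s s' := by
    have h1 : (Multiplicative.ofAdd (1 : ZMod 2)) ≠ 1 := by decide
    have h3 : (Multiplicative.ofAdd (1 : ZMod 2)) * Multiplicative.ofAdd 1 = 1 := by decide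
    rcases multiplicative_zmod_two_eq s with rfl | rfl <;>
      rcases multiplicative_zmod_two_eq s' with rfl | rfl <;> simp [h1, h3, ht]

theorem invHom_generator_apply {A : Type*} [Group A] (hA : ∀ a b : A, a * b = b * a) (a : A) :
    invHom hA (Multiplicative.ofAdd 1) a = a⁻¹ := by
  have h1 : (Multiplicative.ofAdd (1 : ZMod 2)) ≠ 1 := by decide
  simp [invHom, h1, invAut]

/-- If the product of two elements outside `H` lies in `H`, and `K ≤ H` is normal in `G` and
contains the commutators of `H` and the squares of the elements outside `H`, then `G / K` is
generalized dihedral: an element `τ` outside `H` gives an involution of `G / K` that inverts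
`H / K`. -/
theorem exists_mulEquiv_genDihedral [K.Normal] (hKH : K ≤ H)
    (hH : ∀ g ∉ H, ∀ h ∉ H, g * h ∈ H) (hsq : ∀ g ∉ H, g ^ 2 ∈ K) {τ : G} (hτ : τ ∉ H)
    (hA : ∀ a b : H ⧸ K.subgroupOf H, a * b = b * a) :
    ∃ Φ : (G ⧸ K) ≃* GenDihedral hA,
      ∀ g : H, Φ (QuotientGroup.mk (g : G)) =
        SemidirectProduct.inl (QuotientGroup.mk g : H ⧸ K.subgroupOf H) := by
  let t : G ⧸ K := QuotientGroup.mk τ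
  have ht : t * t = 1 := by
    rw [← QuotientGroup.mk_mul, QuotientGroup.eq_one_iff, ← pow_two]
    exact hsq τ hτ
  let f₁ : H ⧸ K.subgroupOf H →* G ⧸ K := QuotientGroup.map _ K H.subtype le_rfl
  let f₂ : Multiplicative (ZMod 2) →* G ⧸ K := homOfSqEqOne t ht
  have h1 : (Multiplicative.ofAdd (1 : ZMod 2)) ≠ 1 := by decide
  have hf₂ : f₂ (Multiplicative.ofAdd 1) = t := by simp [f₂, homOfSqEqOne, h1]
  have hf₁ : ∀ g : H, f₁ (QuotientGroup.mk g) = QuotientGroup.mk (g : G) := fun g => rfl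
  have hcompat : ∀ s, f₁.comp (invHom hA s).toMonoidHom =
      (MulAut.conj (f₂ s)).toMonoidHom.comp f₁ := by
    intro s
    ext g
    rcases multiplicative_zmod_two_eq s with rfl | rfl
    · simp
    · simp only [MonoidHom.comp_apply, MulEquiv.coe_toMonoidHom, QuotientGroup.coe_mk',
        invHom_generator_apply, map_inv, MulAut.conj_apply, hf₁, hf₂]
      rw [eq_comm, ← mul_eq_one_iff_eq_inv]
      change ((τ * g * τ⁻¹ * g : G) : G ⧸ K) = 1
      rw [QuotientGroup.eq_one_iff]
      exact conj_mul_mem_of_sq_mem hsq hτ g.2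
  let Ψ : GenDihedral hA →* G ⧸ K := SemidirectProduct.lift f₁ f₂ hcompat
  have hΨl : ∀ a, Ψ (SemidirectProduct.inl a) = f₁ a := fun a => SemidirectProduct.lift_inl ..
  have hΨr : ∀ s, Ψ (SemidirectProduct.inr s) = f₂ s := fun s => SemidirectProduct.lift_inr ..
  have hinj : Function.Injective Ψ := by
    rw [injective_iff_map_eq_one]
    intro d hd
    rw [← SemidirectProduct.inl_left_mul_inr_right d, map_mul, hΨl, hΨr] at hd
    rw [← SemidirectProduct.inl_left_mul_inr_right d]
    obtain ⟨g, hg⟩ := QuotientGroup.mk_surjective d.left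
    rw [← hg, hf₁] at hd
    rw [← hg]
    rcases multiplicative_zmod_two_eq d.right with h | h
    · rw [h, map_one, mul_one, QuotientGroup.eq_one_iff] at hd
      rw [h, map_one, mul_one, (QuotientGroup.eq_one_iff g).2 (Subgroup.mem_subgroupOf.2 hd),
        map_one]
    · rw [h, hf₂] at hd
      change ((g * τ : G) : G ⧸ K) = 1 at hd
      rw [QuotientGroup.eq_one_iff] at hd
      exact absurd ((H.mul_mem_cancel_left g.2).1 (hKH hd)) hτ
  have hsurj : Function.Surjective Ψ := by
    intro q
    obtain ⟨g, rfl⟩ := QuotientGroup.mk_surjective q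
    by_cases hg : g ∈ H
    · exact ⟨SemidirectProduct.inl (QuotientGroup.mk (⟨g, hg⟩ : H)), hΨl _⟩
    · have hg' : g * τ⁻¹ ∈ H := hH g hg _ fun h => hτ (by simpa using H.inv_mem h)
      refine ⟨SemidirectProduct.inl (QuotientGroup.mk (⟨g * τ⁻¹, hg'⟩ : H)) *
        SemidirectProduct.inr (Multiplicative.ofAdd 1), ?_⟩
      rw [map_mul, hΨl, hΨr, hf₁, hf₂]
      change ((g * τ⁻¹ * τ : G) : G ⧸ K) = _
      rw [inv_mul_cancel_right]
  refine ⟨(MulEquiv.ofBijective Ψ ⟨hinj, hsurj⟩).symm, fun g => ?_⟩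
  rw [MulEquiv.symm_apply_eq]
  exact (hΨl (QuotientGroup.mk g)).symm

end DihedralQuotient

section DihedralAction

variable {C A : Type*} [Group A] (hA : ∀ a b : A, a * b = b * a) (ρ : A →* Equiv.Perm C)

theorem dihedralHom_inl (a : A) :
    dihedralHom hA ρ (SemidirectProduct.inl a) = prodAut C (ρ a, ρ a⁻¹) :=
  SemidirectProduct.lift_inl ..

theorem dihedralHom_inr_generator :
    dihedralHom hA ρ (SemidirectProduct.inr (Multiplicative.ofAdd 1)) = swapAut C := by
  have h1 : (Multiplicative.ofAdd (1 : ZMod 2)) ≠ 1 := by decide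
  have h : dihedralHom hA ρ (SemidirectProduct.inr (Multiplicative.ofAdd 1)) =
      swapHom C (Multiplicative.ofAdd 1) := SemidirectProduct.lift_inr ..
  rw [h]
  simp [swapHom, h1]

theorem mem_dihedralMixed_iff {d : Equiv.Perm (C × C)} :
    d ∈ dihedralMixed hA ρ ↔ ∃ a : A, d = prodAut C (ρ a, ρ a⁻¹) ∨
      d = prodAut C (ρ a, ρ a⁻¹) * swapAut C := by
  constructor
  · rintro ⟨d, rfl⟩
    refine ⟨d.left, ?_⟩
    rw [← dihedralHom_inl hA ρ, ← dihedralHom_inr_generator hA ρ, ← map_mul]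
    rcases multiplicative_zmod_two_eq d.right with h | h
    · left
      conv_lhs => rw [← SemidirectProduct.inl_left_mul_inr_right d, h, map_one, mul_one]
    · right
      conv_lhs => rw [← SemidirectProduct.inl_left_mul_inr_right d, h]
  · rintro ⟨a, rfl | rfl⟩
    · exact ⟨_, dihedralHom_inl hA ρ a⟩
    · exact ⟨SemidirectProduct.inl a * SemidirectProduct.inr (Multiplicative.ofAdd 1), by
        rw [map_mul, dihedralHom_inl, dihedralHom_inr_generator]⟩

end DihedralAction

section Factors

variable {C : Type*}

theorem prodAut_injective [Nonempty C] : Function.Injective (prodAut C) := by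
  rintro ⟨g, h⟩ ⟨g', h'⟩ heq
  obtain ⟨c⟩ := ‹Nonempty C›
  have key : ∀ z, prodAut C (g, h) z = prodAut C (g', h') z := fun z => by rw [heq]
  refine Prod.ext (Equiv.ext fun x => ?_) (Equiv.ext fun y => ?_)
  · exact congrArg Prod.fst (key (x, c))
  · exact congrArg Prod.snd (key (c, y))

theorem prodAut_ne_prodAut_mul_swapAut [Nontrivial C] (p p' : Equiv.Perm C × Equiv.Perm C) :
    prodAut C p ≠ prodAut C p' * swapAut C := by
  intro h
  obtain ⟨x, y, hxy⟩ := exists_pair_ne C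
  have key : ∀ z, p.1 x = p'.1 z := fun z =>
    congrArg (fun f : Equiv.Perm (C × C) => (f (x, z)).1) h
  exact hxy (p'.1.injective ((key x).symm.trans (key y)))

variable [TopologicalSpace C] [ChartedSpace ℂ C]

theorem prodAut_mem_autSq {g h : Equiv.Perm C} (hg : g ∈ HolAut C) (hh : h ∈ HolAut C) :
    prodAut C (g, h) ∈ AutSq C := ⟨(g, h), ⟨hg, hh⟩, rfl⟩

theorem prodAut_mem_autSq_iff [Nonempty C] {g h : Equiv.Perm C} :
    prodAut C (g, h) ∈ AutSq C ↔ g ∈ HolAut C ∧ h ∈ HolAut C := by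
  refine ⟨?_, fun hgh => prodAut_mem_autSq hgh.1 hgh.2⟩
  rintro ⟨p, hp, hpe⟩
  rw [prodAut_injective hpe] at hp
  exact hp

theorem swapAut_mem_autTwo : swapAut C ∈ AutTwo C :=
  Subgroup.mem_sup_right (Subgroup.mem_zpowers _)

/-- The elements of `Aut(C)(2)` outside `Aut(C)²` are the maps `(x, y) ↦ (a y, b x)`. -/
theorem mem_autSq_or_of_mem_autTwo {g : Equiv.Perm (C × C)} (hg : g ∈ AutTwo C) :
    g ∈ AutSq C ∨ ∃ a ∈ HolAut C, ∃ b ∈ HolAut C, g = prodAut C (a, b) * swapAut C := by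
  let T : Subgroup (Equiv.Perm (C × C)) :=
    { carrier := {g | ∃ a ∈ HolAut C, ∃ b ∈ HolAut C,
        g = prodAut C (a, b) ∨ g = prodAut C (a, b) * swapAut C}
      one_mem' := ⟨1, one_mem _, 1, one_mem _, Or.inl rfl⟩
      mul_mem' := by
        rintro _ _ ⟨a, ha, b, hb, rfl | rfl⟩ ⟨a', ha', b', hb', rfl | rfl⟩
        · exact ⟨a * a', mul_mem ha ha', b * b', mul_mem hb hb', Or.inl rfl⟩
        · exact ⟨a * a', mul_mem ha ha', b * b', mul_mem hb hb', Or.inr rfl⟩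
        · exact ⟨a * b', mul_mem ha hb', b * a', mul_mem hb ha', Or.inr rfl⟩
        · exact ⟨a * b', mul_mem ha hb', b * a', mul_mem hb ha', Or.inl rfl⟩
      inv_mem' := by
        rintro _ ⟨a, ha, b, hb, rfl | rfl⟩
        · exact ⟨a⁻¹, inv_mem ha, b⁻¹, inv_mem hb, Or.inl rfl⟩
        · exact ⟨b⁻¹, inv_mem hb, a⁻¹, inv_mem ha, Or.inr rfl⟩ }
  have hT : AutTwo C ≤ T := by
    refine sup_le ?_ ((Subgroup.zpowers_le).2 ⟨1, one_mem _, 1, one_mem _, Or.inr rfl⟩)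
    rintro _ ⟨⟨a, b⟩, ⟨ha, hb⟩, rfl⟩
    exact ⟨a, ha, b, hb, Or.inl rfl⟩
  obtain ⟨a, ha, b, hb, rfl | rfl⟩ := hT hg
  · exact Or.inl (prodAut_mem_autSq ha hb)
  · exact Or.inr ⟨a, ha, b, hb, rfl⟩

theorem continuous_of_mem_autTwo {g : Equiv.Perm (C × C)} (hg : g ∈ AutTwo C) :
    Continuous g := by
  have hsq : ∀ g ∈ AutSq C, Continuous g := by
    rintro _ ⟨⟨a, b⟩, ⟨ha, hb⟩, rfl⟩
    exact (HolAut.continuous ha).prodMap (HolAut.continuous hb)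
  rcases mem_autSq_or_of_mem_autTwo hg with h | ⟨a, ha, b, hb, rfl⟩
  · exact hsq g h
  · exact (hsq _ (prodAut_mem_autSq ha hb)).comp continuous_swap

variable {G : Subgroup (Equiv.Perm (C × C))}

theorem exists_eq_prodAut_mul_swapAut (hG : G ≤ AutTwo C) {g : G} (hg : g ∉ mixedG0 G) :
    ∃ a ∈ HolAut C, ∃ b ∈ HolAut C, (g : Equiv.Perm (C × C)) = prodAut C (a, b) * swapAut C :=
  (mem_autSq_or_of_mem_autTwo (hG g.2)).resolve_left fun h => hg (Subgroup.mem_subgroupOf.2 h)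

theorem mul_mem_mixedG0 (hG : G ≤ AutTwo C) {g h : G} (hg : g ∉ mixedG0 G)
    (hh : h ∉ mixedG0 G) : g * h ∈ mixedG0 G := by
  obtain ⟨a, ha, b, hb, hab⟩ := exists_eq_prodAut_mul_swapAut hG hg
  obtain ⟨a', ha', b', hb', hab'⟩ := exists_eq_prodAut_mul_swapAut hG hh
  rw [mixedG0, Subgroup.mem_subgroupOf, Subgroup.coe_mul, hab, hab']
  exact prodAut_mem_autSq (mul_mem ha hb') (mul_mem hb ha')

theorem mixedG0_normal (hG : G ≤ AutTwo C) : (mixedG0 G).Normal := by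
  refine ⟨fun n hn g => ?_⟩
  by_cases hg : g ∈ mixedG0 G
  · exact mul_mem (mul_mem hg hn) (inv_mem hg)
  · refine mul_mem_mixedG0 hG (fun h => hg ?_) (fun h => hg ?_)
    · exact ((mixedG0 G).mul_mem_cancel_right hn).1 h
    · exact inv_mem_iff.1 h

theorem mixedK_le_mixedG0 (hG : G ≤ AutTwo C) : mixedK G ≤ mixedG0 G := by
  have := mixedG0_normal hG
  refine Subgroup.normalClosure_le_normal ?_
  rintro k ((⟨g, hg, h, hh, hk, -⟩ | ⟨g, hg, h, hh, rfl⟩) | ⟨g, hg, rfl⟩)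
  · rw [SetLike.mem_coe, mixedG0, Subgroup.mem_subgroupOf, hk]
    exact prodAut_mem_autSq hg hh
  · exact mul_mem (mul_mem (mul_mem hg hh) (inv_mem hg)) (inv_mem hh)
  · rw [pow_two]
    exact mul_mem_mixedG0 hG hg hg

theorem mem_mixedK_of_fixed (γ : mixedG0 G) {g h : Equiv.Perm C} (hg : g ∈ HolAut C)
    (hh : h ∈ HolAut C) (hγ : ((γ : G) : Equiv.Perm (C × C)) = prodAut C (g, h)) {x : C}
    (hx : g x = x) : (γ : G) ∈ mixedK G :=
  Subgroup.subset_normalClosure (Or.inl (Or.inl ⟨g, hg, h, hh, hγ, x, hx⟩))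

theorem commutator_mem_mixedK {g h : G} (hg : g ∈ mixedG0 G) (hh : h ∈ mixedG0 G) :
    g * h * g⁻¹ * h⁻¹ ∈ mixedK G :=
  Subgroup.subset_normalClosure (Or.inl (Or.inr ⟨g, hg, h, hh, rfl⟩))

theorem sq_mem_mixedK {g : G} (hg : g ∉ mixedG0 G) : g ^ 2 ∈ mixedK G :=
  Subgroup.subset_normalClosure (Or.inr ⟨g, hg, rfl⟩)

/-- The actions of `G⁰` on the two factors: the pair `(g, h)` with `γ = prodAut C (g, h)`, which is
unique because `C` is nonempty. -/
noncomputable def mixedFactors [Nonempty C] (G : Subgroup (Equiv.Perm (C × C))) :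
    mixedG0 G →* Equiv.Perm C × Equiv.Perm C :=
  ((MonoidHom.ofInjective (prodAut_injective (C := C))).symm.toMonoidHom).comp
    ((G.subtype.comp (mixedG0 G).subtype).codRestrict (prodAut C).range fun γ => by
      obtain ⟨p, -, hp⟩ := Subgroup.mem_subgroupOf.1 γ.2
      exact ⟨p, hp⟩)

theorem prodAut_mixedFactors [Nonempty C] (γ : mixedG0 G) :
    prodAut C (mixedFactors G γ) = ((γ : G) : Equiv.Perm (C × C)) := by
  have h := MonoidHom.ofInjective_apply (f := prodAut C) (prodAut_injective (C := C))
    (x := mixedFactors G γ)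
  rw [← h]
  simp [mixedFactors]

theorem mixedFactors_eq [Nonempty C] {γ : mixedG0 G} {p : Equiv.Perm C × Equiv.Perm C}
    (h : ((γ : G) : Equiv.Perm (C × C)) = prodAut C p) : mixedFactors G γ = p :=
  prodAut_injective ((prodAut_mixedFactors γ).trans h)

theorem mixedFactors_mem [Nonempty C] (γ : mixedG0 G) :
    (mixedFactors G γ).1 ∈ HolAut C ∧ (mixedFactors G γ).2 ∈ HolAut C := by
  rw [← prodAut_mem_autSq_iff, Prod.mk.eta, prodAut_mixedFactors]
  exact Subgroup.mem_subgroupOf.1 γ.2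

theorem mem_mixedKFst_iff [Nonempty C] (hG : G ≤ AutTwo C) {k : Equiv.Perm C} :
    k ∈ mixedKFst G ↔ ∃ κ : mixedG0 G, (κ : G) ∈ mixedK G ∧ (mixedFactors G κ).1 = k := by
  constructor
  · rintro ⟨p, ⟨κ, hκ, hκp⟩, rfl⟩
    refine ⟨⟨κ, mixedK_le_mixedG0 hG hκ⟩, hκ, ?_⟩
    rw [mixedFactors_eq (p := p) hκp]
    rfl
  · rintro ⟨κ, hκ, rfl⟩
    exact ⟨mixedFactors G κ, ⟨κ, hκ, (prodAut_mixedFactors κ).symm⟩, rfl⟩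

theorem mixedKFst_le_holAut [Nonempty C] (hG : G ≤ AutTwo C) : mixedKFst G ≤ HolAut C := by
  intro k hk
  obtain ⟨κ, -, rfl⟩ := (mem_mixedKFst_iff hG).1 hk
  exact (mixedFactors_mem κ).1

theorem finite_mixedKFst [Nonempty C] (hG : G ≤ AutTwo C) [Finite G] : Finite (mixedKFst G) := by
  refine Finite.of_surjective
    (fun κ : {κ : mixedG0 G // (κ : G) ∈ mixedK G} =>
      (⟨(mixedFactors G κ).1, (mem_mixedKFst_iff hG).2 ⟨κ, κ.2, rfl⟩⟩ : mixedKFst G)) ?_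
  rintro ⟨k, hk⟩
  obtain ⟨κ, hκ, rfl⟩ := (mem_mixedKFst_iff hG).1 hk
  exact ⟨⟨κ, hκ⟩, rfl⟩

/-- `G⁰` acts on `C / K` through the first factor, and `K` acts trivially. -/
theorem exists_action_quotient [Nonempty C] (hG : G ≤ AutTwo C) :
    ∃ ρ : G0ModK G →* Equiv.Perm (OrbitSpace (mixedKFst G)), ∀ (γ : mixedG0 G) (x : C),
      ρ (QuotientGroup.mk γ) (orbitMk (mixedKFst G) x) =
        orbitMk (mixedKFst G) ((mixedFactors G γ).1 x) := by
  let π := orbitMk (mixedKFst G)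
  have hwd : ∀ (γ : mixedG0 G) (x y : C), π x = π y →
      π ((mixedFactors G γ).1 x) = π ((mixedFactors G γ).1 y) := by
    intro γ x y hxy
    obtain ⟨k, hk, rfl⟩ := orbitMk_eq_iff.1 hxy
    obtain ⟨κ, hκ, rfl⟩ := (mem_mixedKFst_iff hG).1 hk
    refine orbitMk_eq_iff.2 ⟨_, (mem_mixedKFst_iff hG).2
      ⟨γ * κ * γ⁻¹, (mixedK_normal G).conj_mem _ hκ γ, rfl⟩, ?_⟩
    simp
  let f : mixedG0 G →* Function.End (OrbitSpace (mixedKFst G)) :=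
    { toFun := fun γ => Quotient.lift (fun x => π ((mixedFactors G γ).1 x)) fun x y hxy =>
        hwd γ x y (Quotient.sound hxy)
      map_one' := by
        funext q
        obtain ⟨x, rfl⟩ := orbitMk_surjective _ q
        change π ((mixedFactors G 1).1 x) = π x
        rw [map_one]
        rfl
      map_mul' := fun γ γ' => by
        funext q
        obtain ⟨x, rfl⟩ := orbitMk_surjective _ q
        change π ((mixedFactors G (γ * γ')).1 x) =
          π ((mixedFactors G γ).1 ((mixedFactors G γ').1 x))
        rw [map_mul]
        rfl }
  have hf : ∀ γ x, f.toHomPerm γ (π x) = π ((mixedFactors G γ).1 x) := fun γ x => rfl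
  refine ⟨QuotientGroup.lift _ f.toHomPerm fun κ hκ => ?_, hf⟩
  ext q
  obtain ⟨x, rfl⟩ := orbitMk_surjective _ q
  exact (hf κ x).trans (orbitMk_apply ((mem_mixedKFst_iff hG).2 ⟨κ, hκ, rfl⟩) x)

end Factors

/-! ### The map from the product to the square of the quotient -/

theorem IsCurve.nontrivial {C : Type*} [TopologicalSpace C] [ChartedSpace ℂ C] (hC : IsCurve C) :
    Nontrivial C := by
  have := hC.connectedSpace
  obtain ⟨c⟩ : Nonempty C := inferInstance
  by_contra h
  have : Subsingleton C := not_nontrivial_iff_subsingleton.1 h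
  let φ := chartAt ℂ c
  have hc : φ c ∈ φ.target := φ.map_source (mem_chart_source ℂ c)
  have htgt : φ.target = {φ c} := by
    refine Set.eq_singleton_iff_unique_mem.2 ⟨hc, fun u hu => ?_⟩
    rw [← φ.right_inv hu, Subsingleton.elim (φ.symm u) c]
  exact not_isOpen_singleton (φ c) (htgt ▸ φ.open_target)

/-- The dihedral action attached to a free action is a minimal mixed action. -/
theorem isMinimalMixedAction_dihedralMixed {Q A : Type*} [TopologicalSpace Q] [ChartedSpace ℂ Q]
    [Nontrivial Q] [Group A] [Finite A] (hA : ∀ a b : A, a * b = b * a) (ρ : A →* Equiv.Perm Q)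
    (hρ : ∀ a, ρ a ∈ HolAut Q) (hfree : ∀ a p, ρ a p = p → a = 1) :
    IsMinimalMixedAction (dihedralMixed hA ρ) where
  finite := by
    have : Finite (GenDihedral hA) := Finite.of_equiv _ SemidirectProduct.equivProd.symm
    exact Finite.of_surjective _ (dihedralHom hA ρ).rangeRestrict_surjective
  le_autTwo := by
    intro d hd
    have h : ∀ a, prodAut Q (ρ a, ρ a⁻¹) ∈ AutTwo Q := fun a =>
      Subgroup.mem_sup_left (prodAut_mem_autSq (hρ _) (hρ _))
    obtain ⟨a, rfl | rfl⟩ := (mem_dihedralMixed_iff hA ρ).1 hd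
    · exact h a
    · exact mul_mem (h a) swapAut_mem_autTwo
  not_le_autSq := by
    intro h
    have hd : prodAut Q (ρ 1, ρ 1⁻¹) * swapAut Q ∈ dihedralMixed hA ρ :=
      (mem_dihedralMixed_iff hA ρ).2 ⟨1, Or.inr rfl⟩
    obtain ⟨p, -, hp⟩ := h hd
    exact prodAut_ne_prodAut_mul_swapAut _ _ hp
  faithful_fst := by
    rintro g h - - hgh rfl
    obtain ⟨a, ha | ha⟩ := (mem_dihedralMixed_iff hA ρ).1 hgh
    · obtain ⟨h1, h2⟩ := Prod.ext_iff.1 (prodAut_injective ha)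
      obtain ⟨p⟩ : Nonempty Q := inferInstance
      have ha1 : a = 1 := hfree a p (by
        have h3 : ρ a = 1 := h1.symm
        rw [h3]
        rfl)
      have h4 : h = ρ a⁻¹ := h2
      rw [h4, ha1, inv_one, map_one]
    · exact absurd ha (prodAut_ne_prodAut_mul_swapAut _ _)
  faithful_snd := by
    rintro g h - - hgh rfl
    obtain ⟨a, ha | ha⟩ := (mem_dihedralMixed_iff hA ρ).1 hgh
    · obtain ⟨h1, h2⟩ := Prod.ext_iff.1 (prodAut_injective ha)
      obtain ⟨p⟩ : Nonempty Q := inferInstance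
      have ha1 : a⁻¹ = 1 := hfree a⁻¹ p (by
        have h3 : ρ a⁻¹ = 1 := h2.symm
        rw [h3]
        rfl)
      have h4 : g = ρ a := h1
      rw [h4, inv_eq_one.1 ha1, map_one]
    · exact absurd ha (prodAut_ne_prodAut_mul_swapAut _ _)

section TwistedProjection

variable {C : Type*}

/-- The map `(x, y) ↦ ([x], [a y])` from `C × C` to `C / K × C / K`. -/
def twistedProj (G : Subgroup (Equiv.Perm (C × C))) [TopologicalSpace C] [ChartedSpace ℂ C]
    (a : Equiv.Perm C) (z : C × C) : OrbitSpace (mixedKFst G) × OrbitSpace (mixedKFst G) :=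
  (orbitMk _ z.1, orbitMk _ (a z.2))

variable [TopologicalSpace C] [ChartedSpace ℂ C]
  {G : Subgroup (Equiv.Perm (C × C))} {τ : G} {a b : Equiv.Perm C}
  {hA : ∀ α β : G0ModK G, α * β = β * α} {ρ : G0ModK G →* Equiv.Perm (OrbitSpace (mixedKFst G))}

theorem mk_conj_eq_inv (hG : G ≤ AutTwo C) (hτ : τ ∉ mixedG0 G) (γ : mixedG0 G) :
    (QuotientGroup.mk (⟨τ * γ * τ⁻¹, (mixedG0_normal hG).conj_mem _ γ.2 τ⟩ : mixedG0 G) :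
      G0ModK G) = (QuotientGroup.mk γ)⁻¹ := by
  rw [← mul_eq_one_iff_eq_inv, ← QuotientGroup.mk_mul, QuotientGroup.eq_one_iff,
    Subgroup.mem_subgroupOf]
  exact conj_mul_mem_of_sq_mem (H := mixedG0 G) (fun g hg => sq_mem_mixedK hg) hτ γ.2

theorem prodAut_mem_mixedGK {k : Equiv.Perm C} (hk : k ∈ mixedKFst G) :
    prodAut C (k, 1) ∈ mixedGK G :=
  Subgroup.mem_sup_right ⟨(k, 1), ⟨hk, Subgroup.mem_bot.2 rfl⟩, rfl⟩

theorem mem_mixedGK {g : Equiv.Perm (C × C)} (hg : g ∈ G) : g ∈ mixedGK G :=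
  Subgroup.mem_sup_left hg

variable [Nonempty C]

/-- An element `(g, h)` of `G⁰` acts in the second coordinate of the twisted projection as
`a h a⁻¹`, the first factor of its conjugate by `τ`, which is its inverse modulo `K`. -/
theorem twistedProj_of_mem_mixedG0 (hG : G ≤ AutTwo C) (hτ : τ ∉ mixedG0 G)
    (hab : (τ : Equiv.Perm (C × C)) = prodAut C (a, b) * swapAut C)
    (hρ : ∀ (γ : mixedG0 G) (x : C), ρ (QuotientGroup.mk γ) (orbitMk (mixedKFst G) x) =
      orbitMk (mixedKFst G) ((mixedFactors G γ).1 x)) (γ : mixedG0 G) (z : C × C) :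
    twistedProj G a (((γ : G) : Equiv.Perm (C × C)) z) =
      prodAut _ (ρ (QuotientGroup.mk γ), ρ (QuotientGroup.mk γ)⁻¹) (twistedProj G a z) := by
  let γ' : mixedG0 G := ⟨τ * γ * τ⁻¹, (mixedG0_normal hG).conj_mem _ γ.2 τ⟩
  have hγ' : mixedFactors G γ' =
      (a * (mixedFactors G γ).2 * a⁻¹, b * (mixedFactors G γ).1 * b⁻¹) := by
    apply mixedFactors_eq
    change (τ : Equiv.Perm (C × C)) * ((γ : G) : Equiv.Perm (C × C)) *
      (τ : Equiv.Perm (C × C))⁻¹ = _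
    rw [hab, ← prodAut_mixedFactors γ]
    rfl
  have h1 := hρ γ z.1
  have h2 := hρ γ' (a z.2)
  rw [mk_conj_eq_inv hG hτ γ, hγ'] at h2
  refine Prod.ext ?_ ?_
  · rw [← prodAut_mixedFactors γ]
    exact h1.symm
  · rw [← prodAut_mixedFactors γ]
    refine Eq.trans ?_ h2.symm
    change orbitMk _ (a ((mixedFactors G γ).2 z.2)) =
      orbitMk _ (a ((mixedFactors G γ).2 (a.symm (a z.2))))
    rw [Equiv.symm_apply_apply]

/-- `τ` becomes the exchange of the factors because `a b` is the action of `τ ^ 2`, which lies in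
`K`. -/
theorem twistedProj_swap (hG : G ≤ AutTwo C) (hτ : τ ∉ mixedG0 G)
    (hab : (τ : Equiv.Perm (C × C)) = prodAut C (a, b) * swapAut C) (z : C × C) :
    twistedProj G a ((τ : Equiv.Perm (C × C)) z) = swapAut _ (twistedProj G a z) := by
  let κ : mixedG0 G := ⟨τ ^ 2, mixedK_le_mixedG0 hG (sq_mem_mixedK hτ)⟩
  have hκ : mixedFactors G κ = (a * b, b * a) := by
    apply mixedFactors_eq
    change (τ : Equiv.Perm (C × C)) ^ 2 = _
    rw [hab]
    rfl
  have hmem : a * b ∈ mixedKFst G :=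
    (mem_mixedKFst_iff hG).2 ⟨κ, sq_mem_mixedK hτ, by rw [hκ]⟩
  rw [hab]
  exact Prod.ext rfl (orbitMk_apply hmem z.1)

theorem mixedGK_le_autTwo (hG : G ≤ AutTwo C) : mixedGK G ≤ AutTwo C := by
  refine sup_le hG ?_
  rintro _ ⟨⟨k, l⟩, ⟨hk, hl⟩, rfl⟩
  obtain rfl : l = 1 := Subgroup.mem_bot.1 hl
  exact Subgroup.mem_sup_left (prodAut_mem_autSq (mixedKFst_le_holAut hG hk) (one_mem _))

theorem exists_mem_dihedralMixed_twistedProj (hG : G ≤ AutTwo C) (hτ : τ ∉ mixedG0 G)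
    (hab : (τ : Equiv.Perm (C × C)) = prodAut C (a, b) * swapAut C)
    (hρ : ∀ (γ : mixedG0 G) (x : C), ρ (QuotientGroup.mk γ) (orbitMk (mixedKFst G) x) =
      orbitMk (mixedKFst G) ((mixedFactors G γ).1 x))
    {δ : Equiv.Perm (C × C)} (hδ : δ ∈ mixedGK G) :
    ∃ d ∈ dihedralMixed hA ρ, ∀ z, twistedProj G a (δ z) = d (twistedProj G a z) := by
  let T : Subgroup (Equiv.Perm (C × C)) :=
    { carrier := {δ | ∃ d ∈ dihedralMixed hA ρ,
        ∀ z, twistedProj G a (δ z) = d (twistedProj G a z)}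
      one_mem' := ⟨1, one_mem _, fun z => rfl⟩
      mul_mem' := by
        rintro δ δ' ⟨d, hd, h⟩ ⟨d', hd', h'⟩
        refine ⟨d * d', mul_mem hd hd', fun z => ?_⟩
        rw [Equiv.Perm.mul_apply, Equiv.Perm.mul_apply, h, h']
      inv_mem' := by
        rintro δ ⟨d, hd, h⟩
        refine ⟨d⁻¹, inv_mem hd, fun z => ?_⟩
        rw [Equiv.Perm.eq_inv_iff_eq, ← h, ← Equiv.Perm.mul_apply, mul_inv_cancel,
          Equiv.Perm.one_apply] }
  have h0 : ∀ γ : mixedG0 G, ((γ : G) : Equiv.Perm (C × C)) ∈ T := fun γ =>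
    ⟨_, (mem_dihedralMixed_iff hA ρ).2 ⟨QuotientGroup.mk γ, Or.inl rfl⟩,
      twistedProj_of_mem_mixedG0 hG hτ hab hρ γ⟩
  have hτT : (τ : Equiv.Perm (C × C)) ∈ T :=
    ⟨swapAut _, ⟨_, dihedralHom_inr_generator hA ρ⟩, twistedProj_swap hG hτ hab⟩
  have hT : mixedGK G ≤ T := by
    refine sup_le (fun g hg => ?_) ?_
    · by_cases hg0 : (⟨g, hg⟩ : G) ∈ mixedG0 G
      · exact h0 ⟨⟨g, hg⟩, hg0⟩
      · have hg' : (⟨g, hg⟩ : G) * τ⁻¹ ∈ mixedG0 G :=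
          mul_mem_mixedG0 hG hg0 fun h => hτ (inv_mem_iff.1 h)
        have h := T.mul_mem (h0 ⟨_, hg'⟩) hτT
        have hgτ : g * (τ : Equiv.Perm (C × C))⁻¹ * τ ∈ T := h
        rwa [inv_mul_cancel_right] at hgτ
    · rintro _ ⟨⟨k, l⟩, ⟨hk, hl⟩, rfl⟩
      obtain rfl : l = 1 := Subgroup.mem_bot.1 hl
      exact ⟨1, one_mem _, fun z => Prod.ext (orbitMk_apply hk z.1) rfl⟩
  exact hT hδ

theorem exists_mem_mixedGK_twistedProj (hG : G ≤ AutTwo C) (hτ : τ ∉ mixedG0 G)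
    (hab : (τ : Equiv.Perm (C × C)) = prodAut C (a, b) * swapAut C)
    (hρ : ∀ (γ : mixedG0 G) (x : C), ρ (QuotientGroup.mk γ) (orbitMk (mixedKFst G) x) =
      orbitMk (mixedKFst G) ((mixedFactors G γ).1 x))
    {d : Equiv.Perm (OrbitSpace (mixedKFst G) × OrbitSpace (mixedKFst G))}
    (hd : d ∈ dihedralMixed hA ρ) :
    ∃ δ ∈ mixedGK G, ∀ z, twistedProj G a (δ z) = d (twistedProj G a z) := by
  obtain ⟨α, hα⟩ := (mem_dihedralMixed_iff hA ρ).1 hd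
  obtain ⟨γ, rfl⟩ := QuotientGroup.mk_surjective α
  have hγ := twistedProj_of_mem_mixedG0 hG hτ hab hρ γ
  rcases hα with rfl | rfl
  · exact ⟨_, mem_mixedGK (γ : G).2, hγ⟩
  · refine ⟨((γ : G) : Equiv.Perm (C × C)) * τ, mem_mixedGK (mul_mem (γ : G).2 τ.2), fun z => ?_⟩
    rw [Equiv.Perm.mul_apply, hγ, twistedProj_swap hG hτ hab]
    rfl

/-- The group `G_K` contains `{1} × a⁻¹ K a`, hence is transitive on the fibres of the twisted
projection. -/
theorem exists_mem_mixedGK_of_twistedProj_eq (hG : G ≤ AutTwo C)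
    (hab : (τ : Equiv.Perm (C × C)) = prodAut C (a, b) * swapAut C) {z z' : C × C}
    (h : twistedProj G a z = twistedProj G a z') : ∃ δ ∈ mixedGK G, δ z = z' := by
  obtain ⟨h1, h2⟩ := Prod.ext_iff.1 h
  obtain ⟨k, hk, hkz⟩ := orbitMk_eq_iff.1 h1
  obtain ⟨k₂, hk₂, hkz₂⟩ := orbitMk_eq_iff.1 h2
  obtain ⟨κ, hκ, rfl⟩ := (mem_mixedKFst_iff hG).1 hk₂
  -- the conjugate `τ⁻¹ κ τ` acts on the second factor as `a⁻¹ k₂ a`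
  have hκ'K : τ⁻¹ * κ * τ ∈ mixedK G := by
    simpa using (mixedK_normal G).conj_mem _ hκ τ⁻¹
  let κ' : mixedG0 G := ⟨τ⁻¹ * κ * τ, mixedK_le_mixedG0 hG hκ'K⟩
  have hκ' : mixedFactors G κ' =
      (b⁻¹ * (mixedFactors G κ).2 * b, a⁻¹ * (mixedFactors G κ).1 * a) := by
    apply mixedFactors_eq
    change (τ : Equiv.Perm (C × C))⁻¹ * ((κ : G) : Equiv.Perm (C × C)) * τ = _
    rw [hab, ← prodAut_mixedFactors κ]
    rfl
  have hmem : (mixedFactors G κ').1 ∈ mixedKFst G := (mem_mixedKFst_iff hG).2 ⟨κ', hκ'K, rfl⟩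
  refine ⟨prodAut C (k * (mixedFactors G κ').1⁻¹, 1) * ((κ' : G) : Equiv.Perm (C × C)),
    mul_mem (prodAut_mem_mixedGK (mul_mem hk (inv_mem hmem))) (mem_mixedGK (κ' : G).2), ?_⟩
  rw [← prodAut_mixedFactors κ']
  refine Prod.ext ?_ ?_
  · change (k * (mixedFactors G κ').1⁻¹) ((mixedFactors G κ').1 z.1) = z'.1
    rw [← Equiv.Perm.mul_apply, inv_mul_cancel_right, hkz]
  · change (mixedFactors G κ').2 z.2 = z'.2
    rw [hκ']
    change a.symm ((mixedFactors G κ).1 (a z.2)) = z'.2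
    rw [hkz₂, Equiv.symm_apply_apply]

/-- The twisted projection identifies the orbits of `G_K` with those of the dihedral action. -/
theorem orbitMk_twistedProj_eq_iff (hG : G ≤ AutTwo C) (hτ : τ ∉ mixedG0 G)
    (hab : (τ : Equiv.Perm (C × C)) = prodAut C (a, b) * swapAut C)
    (hρ : ∀ (γ : mixedG0 G) (x : C), ρ (QuotientGroup.mk γ) (orbitMk (mixedKFst G) x) =
      orbitMk (mixedKFst G) ((mixedFactors G γ).1 x)) {z z' : C × C} :
    orbitMk (dihedralMixed hA ρ) (twistedProj G a z) =
      orbitMk (dihedralMixed hA ρ) (twistedProj G a z') ↔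
    orbitMk (mixedGK G) z = orbitMk (mixedGK G) z' := by
  rw [orbitMk_eq_iff, orbitMk_eq_iff]
  constructor
  · rintro ⟨d, hd, h⟩
    obtain ⟨δ, hδ, hδd⟩ := exists_mem_mixedGK_twistedProj hG hτ hab hρ hd
    obtain ⟨δ', hδ', h'⟩ := exists_mem_mixedGK_of_twistedProj_eq hG hab ((hδd z).trans h)
    exact ⟨δ' * δ, mul_mem hδ' hδ, h'⟩
  · rintro ⟨δ, hδ, rfl⟩
    obtain ⟨d, hd, h⟩ := exists_mem_dihedralMixed_twistedProj (hA := hA) hG hτ hab hρ hδ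
    exact ⟨d, hd, (h z).symm⟩

end TwistedProjection

/-- Two open quotient maps with the same fibres have homeomorphic targets. -/
theorem IsOpenQuotientMap.exists_homeomorph {X Y Z : Type*} [TopologicalSpace X]
    [TopologicalSpace Y] [TopologicalSpace Z] {f : X → Y} {g : X → Z} (hf : IsOpenQuotientMap f)
    (hg : IsOpenQuotientMap g) (h : ∀ x x', g x = g x' ↔ f x = f x') :
    ∃ e : Y ≃ₜ Z, ∀ x, e (f x) = g x := by
  let F : Y → Z := fun y => g (Function.surjInv hf.surjective y)
  have hF : ∀ x, F (f x) = g x := fun x =>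
    (h _ _).2 (Function.surjInv_eq hf.surjective (f x))
  have hFf : F ∘ f = g := funext hF
  have hbij : Function.Bijective F := by
    constructor
    · intro y y' hyy'
      obtain ⟨x, rfl⟩ := hf.surjective y
      obtain ⟨x', rfl⟩ := hf.surjective y'
      rw [hF, hF] at hyy'
      exact (h _ _).1 hyy'
    · intro z
      obtain ⟨x, rfl⟩ := hg.surjective z
      exact ⟨f x, hF x⟩
  have hcont : Continuous F := hf.continuous_comp_iff.1 (hFf ▸ hg.continuous)
  have hopen : IsOpenMap F := hf.isOpenMap_iff.2 (hFf ▸ hg.isOpenMap)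
  exact ⟨(Equiv.ofBijective F hbij).toHomeomorphOfContinuousOpen hcont hopen, hF⟩

theorem mdifferentiable_twistedProj {C : Type*} [TopologicalSpace C] [ChartedSpace ℂ C]
    {G : Subgroup (Equiv.Perm (C × C))} [ChartedSpace ℂ (OrbitSpace (mixedKFst G))]
    (hπ : MDifferentiable 𝓘(ℂ, ℂ) 𝓘(ℂ, ℂ) (orbitMk (mixedKFst G))) {a : Equiv.Perm C}
    (ha : a ∈ HolAut C) :
    MDifferentiable (𝓘(ℂ, ℂ).prod 𝓘(ℂ, ℂ)) (𝓘(ℂ, ℂ).prod 𝓘(ℂ, ℂ)) (twistedProj G a) := fun _ =>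
  ((hπ _).comp _ mdifferentiableAt_fst).prodMk
    ((hπ _).comp _ ((ha.1 _).comp _ mdifferentiableAt_snd))

/-- A homeomorphism induced by the twisted projection is an isomorphism of complex spaces. -/
theorem isBiholomorphism_of_twistedProj {C : Type*} [TopologicalSpace C] [ChartedSpace ℂ C]
    {G : Subgroup (Equiv.Perm (C × C))} [ChartedSpace ℂ (OrbitSpace (mixedKFst G))]
    [IsManifold 𝓘(ℂ, ℂ) ω (OrbitSpace (mixedKFst G))] (hQ : IsQuotientStructure (mixedKFst G))
    (hπ : IsOpenQuotientMap (orbitMk (mixedKFst G))) {a : Equiv.Perm C} (ha : a ∈ HolAut C)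
    {Γ : Subgroup (Equiv.Perm (C × C))} (hΓ : Continuous (orbitMk Γ))
    {D : Subgroup (Equiv.Perm (OrbitSpace (mixedKFst G) × OrbitSpace (mixedKFst G)))}
    (hD : Continuous (orbitMk D)) (e : OrbitSpace Γ ≃ₜ OrbitSpace D)
    (he : ∀ z, e (orbitMk Γ z) = orbitMk D (twistedProj G a z)) :
    IsBiholomorphism (𝓘(ℂ, ℂ).prod 𝓘(ℂ, ℂ)) (𝓘(ℂ, ℂ).prod 𝓘(ℂ, ℂ)) Γ D e := by
  intro V hV f
  have hcomp : (f ∘ e) ∘ orbitMk Γ = (f ∘ orbitMk D) ∘ twistedProj G a :=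
    funext fun z => congrArg f (he z)
  have hpre : ∀ z, z ∈ orbitMk Γ ⁻¹' (e ⁻¹' V) ↔ twistedProj G a z ∈ orbitMk D ⁻¹' V := fun z => by
    simp only [Set.mem_preimage, he]
  have hW : IsOpen (orbitMk D ⁻¹' V) := hV.preimage hD
  have hW' : IsOpen (orbitMk Γ ⁻¹' (e ⁻¹' V)) := (hV.preimage e.continuous).preimage hΓ
  unfold IsHolOnQuotient
  rw [hcomp]
  constructor
  · intro hf z hz
    apply MDifferentiableAt.mdifferentiableWithinAt
    have hz' := (hpre z).1 hz
    exact ((hf _ hz').mdifferentiableAt (hW.mem_nhds hz')).comp z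
      (mdifferentiable_twistedProj (hQ.mdifferentiable_orbitMk hπ) ha z)
  · intro hf
    refine hQ.mdifferentiableOn_prod hπ hW fun x y hxy => ?_
    let s : C × C → C × C := fun z => (z.1, a⁻¹ z.2)
    have hs : ∀ z, twistedProj G a (s z) = (orbitMk _ z.1, orbitMk _ z.2) := fun z => by
      simp [s, twistedProj]
    have hsz : s (x, y) ∈ orbitMk Γ ⁻¹' (e ⁻¹' V) := (hpre _).2 (by rwa [hs])
    have hsd : MDifferentiableAt (𝓘(ℂ, ℂ).prod 𝓘(ℂ, ℂ)) (𝓘(ℂ, ℂ).prod 𝓘(ℂ, ℂ)) s (x, y) :=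
      mdifferentiableAt_fst.prodMk ((ha.2 _).comp _ mdifferentiableAt_snd)
    have h := ((hf _ hsz).mdifferentiableAt (hW'.mem_nhds hsz)).comp (x, y) hsd
    refine h.congr_of_eventuallyEq (Eventually.of_forall fun z => ?_)
    exact congrArg (f ∘ orbitMk D) (hs z).symm

/-! ### The dihedral surface of a minimal mixed action -/

theorem proposition4p8 {C : Type*} [TopologicalSpace C] [ChartedSpace ℂ C] (hC : IsCurve C)
    (G : Subgroup (Equiv.Perm (C × C))) (hG : IsMinimalMixedAction G) :
    mixedK G ≤ mixedG0 G ∧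
    -- the group `G⁰/K` is abelian
    ∃ hA : ∀ a b : G0ModK G, a * b = b * a,
      -- `G/K` is the generalized dihedral group of `G⁰/K`
      (∃ Φ : (G ⧸ mixedK G) ≃* GenDihedral hA,
        ∀ g : mixedG0 G, Φ (QuotientGroup.mk (g : G)) =
          SemidirectProduct.inl (QuotientGroup.mk g : G0ModK G)) ∧
      -- the quotient `C/K` is a curve
      ∃ _ : ChartedSpace ℂ (OrbitSpace (mixedKFst G)),
        IsCurve (OrbitSpace (mixedKFst G)) ∧ IsQuotientStructure (mixedKFst G) ∧
        -- `G⁰/K` acts freely on `C/K`, by the action induced by the first factor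
        ∃ ρ : G0ModK G →* Equiv.Perm (OrbitSpace (mixedKFst G)),
          (∀ a, ρ a ∈ HolAut (OrbitSpace (mixedKFst G))) ∧
          (∀ (γ : mixedG0 G) (x y : C),
            ρ (QuotientGroup.mk γ) (orbitMk (mixedKFst G) x) =
              orbitMk (mixedKFst G) (((γ : G) : Equiv.Perm (C × C)) (x, y)).1) ∧
          (∀ (a : G0ModK G) (p : OrbitSpace (mixedKFst G)), ρ a p = p → a = 1) ∧
          -- `D(G⁰/K)` acts on `C/K × C/K` by a minimal mixed action
          IsMinimalMixedAction (dihedralMixed hA ρ) ∧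
          -- `(C × C)/G_K` is the quotient of `C/K × C/K` by this action
          ∃ e : OrbitSpace (mixedGK G) ≃ₜ OrbitSpace (dihedralMixed hA ρ),
            IsBiholomorphism (𝓘(ℂ, ℂ).prod 𝓘(ℂ, ℂ)) (𝓘(ℂ, ℂ).prod 𝓘(ℂ, ℂ))
              (mixedGK G) (dihedralMixed hA ρ) e ∧
            ∃ ψ ∈ HolAut C, ∀ x y : C,
              e (orbitMk (mixedGK G) (x, y)) = orbitMk (dihedralMixed hA ρ)
                (orbitMk (mixedKFst G) x, orbitMk (mixedKFst G) (ψ y)) := by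
  have hGA := hG.le_autTwo
  have := hG.finite
  have := hC.nontrivial
  obtain ⟨g, hgG, hg⟩ := Set.not_subset.1 hG.not_le_autSq
  let τ : G := ⟨g, hgG⟩
  have hτ : τ ∉ mixedG0 G := fun h => hg (Subgroup.mem_subgroupOf.1 h)
  obtain ⟨a, ha, b, -, hab⟩ := exists_eq_prodAut_mul_swapAut hGA hτ
  have hA : ∀ α β : G0ModK G, α * β = β * α :=
    commutes_quotient_of_commutators_mem fun g hg h hh => commutator_mem_mixedK hg hh
  have hKA := mixedKFst_le_holAut hGA
  have := finite_mixedKFst hGA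
  obtain ⟨cs, hQC, hQ⟩ := hC.exists_quotient (mixedKFst G) hKA
  have := hC.isManifold
  have := hQC.isManifold
  have := hQC.nontrivial
  have hπ : IsOpenQuotientMap (orbitMk (mixedKFst G)) :=
    isOpenQuotientMap_orbitMk _ fun k hk => HolAut.continuous (hKA hk)
  obtain ⟨ρ, hρ⟩ := exists_action_quotient hGA
  have hρd : ∀ α, MDifferentiable 𝓘(ℂ, ℂ) 𝓘(ℂ, ℂ) (ρ α) := by
    intro α
    obtain ⟨γ, rfl⟩ := QuotientGroup.mk_surjective α
    refine hQ.mdifferentiable_of_comp hπ ?_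
    simp only [hρ]
    exact (hQ.mdifferentiable_orbitMk hπ).comp (mixedFactors_mem γ).1.1
  have hρA : ∀ α, ρ α ∈ HolAut (OrbitSpace (mixedKFst G)) := by
    refine fun α => ⟨hρd α, ?_⟩
    have h := hρd α⁻¹
    rwa [map_inv] at h
  -- if `γ x` and `x` are in the same `K`-orbit, then `κ γ` fixes `x` for some `κ` in `K`,
  -- so `κ γ` lies in `Σ`
  have hfree : ∀ (α : G0ModK G) (p : OrbitSpace (mixedKFst G)), ρ α p = p → α = 1 := by
    intro α p hp
    obtain ⟨γ, rfl⟩ := QuotientGroup.mk_surjective α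
    obtain ⟨x, rfl⟩ := orbitMk_surjective _ p
    rw [hρ, orbitMk_eq_iff] at hp
    obtain ⟨k, hk, hkx⟩ := hp
    obtain ⟨κ, hκ, rfl⟩ := (mem_mixedKFst_iff hGA).1 hk
    have hmem := mixedFactors_mem (κ * γ)
    have h := mem_mixedK_of_fixed (κ * γ) hmem.1 hmem.2 (prodAut_mixedFactors (κ * γ)).symm
      (x := x) (by rwa [map_mul])
    rw [QuotientGroup.eq_one_iff, Subgroup.mem_subgroupOf]
    exact ((mixedK G).mul_mem_cancel_left hκ).1 h
  have hmin := isMinimalMixedAction_dihedralMixed hA ρ hρA hfree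
  have hπD : IsOpenQuotientMap (orbitMk (dihedralMixed hA ρ)) :=
    isOpenQuotientMap_orbitMk _ fun d hd => continuous_of_mem_autTwo (hmin.le_autTwo hd)
  have hπG : IsOpenQuotientMap (orbitMk (mixedGK G)) :=
    isOpenQuotientMap_orbitMk _ fun δ hδ =>
      continuous_of_mem_autTwo (mixedGK_le_autTwo hGA hδ)
  have ha' : IsOpenQuotientMap a :=
    (⟨a, HolAut.continuous ha, ha.2.continuous⟩ : C ≃ₜ C).isOpenQuotientMap
  have hq : IsOpenQuotientMap (twistedProj G a) := hπ.prodMap (hπ.comp ha')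
  obtain ⟨e, he⟩ := hπG.exists_homeomorph (hπD.comp hq) fun z z' =>
    orbitMk_twistedProj_eq_iff hGA hτ hab hρ
  refine ⟨mixedK_le_mixedG0 hGA, hA,
    exists_mulEquiv_genDihedral (mixedK_le_mixedG0 hGA) (fun g hg h hh => mul_mem_mixedG0 hGA hg hh)
      (fun g hg => sq_mem_mixedK hg) hτ hA,
    cs, hQC, hQ, ρ, hρA, fun γ x y => ?_, hfree, hmin, e,
    isBiholomorphism_of_twistedProj hQ hπ ha hπG.continuous hπD.continuous e he, a, ha,
    fun x y => he (x, y)⟩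
  rw [hρ, ← prodAut_mixedFactors γ]
  rfl
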